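/- Let $n\ge 2$ be even and consider the square grid $G_n$ on the $n\times n$ torus, with vertex set $(\mathbb Z/n)^2$ and $2n^2$ edges (one from each vertex $p$ to $p+(1,0)$ and one from $p$ to $p+(0,1)$). Let $F_n$ be the associated Fisher graph on the torus: each vertex $p$ of $G_n$ is replaced by six vertices $p_W,p_S,p_A,p_E,p_N,p_B$ forming the two triangles $\{p_W,p_S,p_A\}$ and $\{p_E,p_N,p_B\}$, joined by the edge $p_Ap_B$, and the grid edges from $p$ to $p+(1,0)$ and to $p+(0,1)$ become the edges joining $p_E$ to $(p+(1,0))_W$ and $p_N$ to $(p+(0,1))_S$. Given weights $x=(x_e)\in\mathbb R^{E(G_n)}\cong\mathbb R^{2n^2}$ on the grid edges, give the corresponding edges of $F_n$ these weights and all other edges of $F_n$ weight $1$. Fix an orientation of $F_n$ that comes from a clockwise-odd orientation of the planar Fisher graph (every face, traversed clockwise, has an odd number of edges pointing along the traversal) invariant under all translations of the square grid $\mathbb Z^2$. Let $\gamma_x$ ($\gamma_y$) be a dual path winding once around the torus horizontally (vertically). Let $K(z,w)$ be the Kasteleyn matrix, indexed by the vertices of $F_n$: an edge of weight $W$ oriented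 from $u$ to $v$ contributes $W$ to the entry $(u,v)$ and $-W$ to the entry $(v,u)$, these being multiplied by $z$ and $z^{-1}$, respectively, if the edge is crossed by $\gamma_x$, and by $w$ and $w^{-1}$, respectively, if it is crossed by $\gamma_y$. Put $P(z,w)=\det K(z,w)$, which depends on the weights $x$. **Lemma.** For all couplings $0<J_1,\dots,J_{2n^2}<\infty$ on the edges of $G_n$, the curve $$\gamma(t)=(\tanh tJ_1,\dots,\tanh tJ_{2n^2}),\qquad 0\le t\le+\infty\qquad(\gamma(+\infty)=(1,\dots,1)),$$ in the edge-weight space $\mathbb R^{2n^2}$ meets the surface $\{P(1,1)=0\}$ in exactly one point $\gamma(t_0)$; moreover $0<t_0<+\infty$ and $t_0$ is the only parameter $t\in[0,+\infty]$ with $\gamma(t)\in\{P(1,1)=0\}$. In other words, $\beta=t_0$ is the unique reciprocal temperature at which the dimer model with weights $\tanh\beta J_k$ satisfies $P(1,1)=0$. -/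

import Mathlib

/-- The six vertices of the Fisher gadget that replaces one vertex of the square grid.  The gadget
is a pair of triangles, `{west, south, inner}` and `{east, north, outer}`, joined by the edge
between `inner` and `outer`.  The vertices `west`, `south`, `east`, `north` carry the four
square-grid edges, in these directions. -/
inductive GadgetVertex
  | west | south | inner | east | north | outer
  deriving DecidableEq

instance : Fintype GadgetVertex where
  elems := {.west, .south, .inner, .east, .north, .outer}
  complete a := by cases a <;> decide

/-- The nine translation classes of edges of the Fisher graph (the honeycomb lattice with every
vertex replaced by a triangle).  A cell consists of the six triangle edges and the `a`-edge of one
gadget, together with the square-grid edges that leave it to the right (`horizontal`) and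
upwards (`vertical`). -/
inductive EdgeClass
  | westInner | innerSouth | southWest
  | eastOuter | outerNorth | northEast
  | aEdge
  | horizontal | vertical
  deriving DecidableEq

instance : Fintype EdgeClass where
  elems := {.westInner, .innerSouth, .southWest, .eastOuter, .outerNorth, .northEast, 
    .aEdge, .horizontal, .vertical}
  complete a := by cases a <;> decide

/-- The two directions of edges of the square grid. -/
inductive GridDir
  | right | up
  deriving DecidableEq

instance : Fintype GridDir where
  elems := {.right, .up}
  complete a := by cases a <;> decide

/-- Vertices of the square grid embedded in the `n × n` torus. -/
abbrev TorusCell (n : ℕ) := ZMod n × ZMod n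

/-- Edges of the square grid on the `n × n` torus: `(p, right)` joins `p` to `p + (1, 0)`, and
`(p, up)` joins `p` to `p + (0, 1)`. -/
abbrev GridEdge (n : ℕ) := TorusCell n × GridDir

/-- Vertices of the Fisher graph on the `n × n` torus. -/
abbrev FisherVertex (n : ℕ) := TorusCell n × GadgetVertex

/-- Edges of the Fisher graph on the `n × n` torus. -/
abbrev FisherEdge (n : ℕ) := TorusCell n × EdgeClass

/-- There are `2n²` grid edges, so the edge-weight space has dimension `2n²`. -/
theorem card_gridEdge (n : ℕ) [NeZero n] : Fintype.card (GridEdge n) = 2 * n ^ 2 := by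
  have h : Fintype.card GridDir = 2 := rfl
  simp only [GridEdge, TorusCell, Fintype.card_prod, ZMod.card, h]
  ring

/-- First endpoint of a Fisher edge, in its reference direction. -/
def edgeStart {n : ℕ} (e : FisherEdge n) : FisherVertex n :=
  match e.2 with
  | .westInner => (e.1, .west)
  | .innerSouth => (e.1, .inner)
  | .southWest => (e.1, .south)
  | .eastOuter => (e.1, .east)
  | .outerNorth => (e.1, .outer)
  | .northEast => (e.1, .north)
  | .aEdge => (e.1, .inner)
  | .horizontal => (e.1, .east)
  | .vertical => (e.1, .north)

/-- Second endpoint of a Fisher edge, in its reference direction. -/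
def edgeEnd {n : ℕ} (e : FisherEdge n) : FisherVertex n :=
  match e.2 with
  | .westInner => (e.1, .inner)
  | .innerSouth => (e.1, .south)
  | .southWest => (e.1, .west)
  | .eastOuter => (e.1, .outer)
  | .outerNorth => (e.1, .north)
  | .northEast => (e.1, .east)
  | .aEdge => (e.1, .outer)
  | .horizontal => ((e.1.1 + 1, e.1.2), .west)
  | .vertical => ((e.1.1, e.1.2 + 1), .south)

/-- A translation-invariant orientation of the Fisher graph: `true` means that all edges of the
class are oriented in their reference direction, `false` that they are oriented against it. -/
abbrev FisherOrientation := EdgeClass → Bool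

/-- The faces of the Fisher graph in the plane, up to translation: the two triangles and the
dodecagon.  Each is listed as its boundary traversed clockwise, every edge being paired with
`true` if it is traversed in its reference direction and with `false` otherwise.

In a gadget centred at the origin one may place `west, south, inner` at `(-3,0), (0,-3), (-1,-1)`
and `east, north, outer` at `(3,0), (0,3), (1,1)` (consecutive gadgets being at distance 10).
The dodecagon listed is the one inside the grid square with corners `p`, `p + (0,1)`,
`p + (1,1)`, `p + (1,0)`: from `north` of `p` up to `south` of `p + (0,1)`, there along
`south, inner, outer, east`, then to `west` of `p + (1,1)`, there to `south`, then down to `north`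
of `p + (1,0)`, there along `north, outer, inner, west`, then back to `east` of `p`, and from
there to `north` of `p`. -/
def fisherFaces : List (List (EdgeClass × Bool)) :=
  [ [(.westInner, true), (.innerSouth, true), (.southWest, true)],
    [(.eastOuter, true), (.outerNorth, true), (.northEast, true)],
    [(.vertical, true),
     (.innerSouth, false), (.aEdge, true), (.eastOuter, false),
     (.horizontal, true),
     (.southWest, false),
     (.vertical, false),
     (.outerNorth, false), (.aEdge, false), (.westInner, false),
     (.horizontal, false),
     (.northEast, false)] ]

/-- An orientation is clockwise odd if every face, traversed clockwise, has an odd number of edges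
pointing along the traversal. -/
def FisherOrientation.ClockwiseOdd (o : FisherOrientation) : Prop :=
  ∀ face ∈ fisherFaces, Odd (face.countP fun d => o d.1 == d.2)

/-- The tail of a Fisher edge with respect to an orientation. -/
def FisherOrientation.tail {n : ℕ} (o : FisherOrientation) (e : FisherEdge n) : FisherVertex n :=
  if o e.2 then edgeStart e else edgeEnd e

/-- The head of a Fisher edge with respect to an orientation. -/
def FisherOrientation.head {n : ℕ} (o : FisherOrientation) (e : FisherEdge n) : FisherVertex n :=
  if o e.2 then edgeEnd e else edgeStart e

/-- The weights of the Fisher graph determined by weights `x` of the grid edges: an edge of the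
Fisher graph that corresponds to a grid edge inherits its weight, all the other edges (triangle
edges and `a`-edges) have weight 1. -/
def fisherWeight {n : ℕ} (x : GridEdge n → ℝ) (e : FisherEdge n) : ℝ :=
  match e.2 with
  | .horizontal => x (e.1, .right)
  | .vertical => x (e.1, .up)
  | _ => 1

/-- The edges crossed by `γ_x`, the dual path winding once around the torus horizontally, between
the rows `-1` and `0`. -/
def CrossesX {n : ℕ} (e : FisherEdge n) : Prop :=
  e.2 = .vertical ∧ e.1.2 + 1 = 0

/-- The edges crossed by `γ_y`, the dual path winding once around the torus vertically, between
the columns `-1` and `0`. -/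
def CrossesY {n : ℕ} (e : FisherEdge n) : Prop :=
  e.2 = .horizontal ∧ e.1.1 + 1 = 0

open Classical in
/-- The factor `z` for edges crossed by `γ_x`, the factor `w` for edges crossed by `γ_y`. -/
noncomputable def crossingFactor {n : ℕ} (z w : ℂ) (e : FisherEdge n) : ℂ :=
  (if CrossesX e then z else 1) * (if CrossesY e then w else 1)

open Classical in
/-- The Kasteleyn matrix `K(z, w)` of the Fisher graph on the `n × n` torus, with weights `x` on the
grid edges.  An edge `e` of weight `W` oriented from `u` to `v` contributes `W` to the entry
`(u, v)` and `-W` to the entry `(v, u)`; if `e` is crossed by `γ_x` these are multiplied by `z` and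
`z⁻¹` respectively, and if it is crossed by `γ_y`, by `w` and `w⁻¹`. -/
noncomputable def kasteleynMatrix {n : ℕ} [NeZero n] (o : FisherOrientation) (x : GridEdge n → ℝ)
    (z w : ℂ) : Matrix (FisherVertex n) (FisherVertex n) ℂ :=
  fun u v => ∑ e : FisherEdge n,
    ((if o.tail e = u ∧ o.head e = v then (fisherWeight x e : ℂ) * crossingFactor z w e else 0)
      - (if o.tail e = v ∧ o.head e = u then
          (fisherWeight x e : ℂ) * (crossingFactor z w e)⁻¹ else 0))

/-- The characteristic polynomial `P(z, w) = det K(z, w)` of the dimer model. -/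
noncomputable def charPoly {n : ℕ} [NeZero n] (o : FisherOrientation) (x : GridEdge n → ℝ)
    (z w : ℂ) : ℂ :=
  (kasteleynMatrix o x z w).det

/-- The surface `P(1, 1) = 0` in the edge-weight space. -/
def criticalSurface (n : ℕ) [NeZero n] (o : FisherOrientation) : Set (GridEdge n → ℝ) :=
  {x | charPoly o x 1 1 = 0}

open Classical in
/-- The curve `γ(t) = (tanh (t J_e))_e`, `0 ≤ t ≤ +∞`, in the edge-weight space; for positive
couplings its endpoint is `γ(+∞) = (1, …, 1)`, since `tanh (+∞) = 1`. -/
noncomputable def weightCurve {n : ℕ} (J : GridEdge n → ℝ) (t : ENNReal) : GridEdge n → ℝ :=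
  fun e => if t = ⊤ then 1 else Real.tanh (t.toReal * J e)

/-! By Fisher's correspondence, perfect matchings of the Fisher graph are even sets `S` of grid
edges: `S` consists of the grid edges in the matching, and evenness at a vertex leaves exactly one
way to match the rest of its gadget. So the Pfaffian of `K(1,1)`, which vanishes exactly when
`P(1,1)` does, is a signed sum of weights over even sets (`pfaffianSum_realKasteleyn`). Sums of face
boundaries carry the sign of the empty set and all other even sets the opposite sign
(`matchingPfaffian_eq`). Up to a nonzero constant the Pfaffian is therefore `signedWeight x = 2
Z₀(x) - Z(x)`, where `Z` is the total weight of the even sets and `Z₀` that of the null-homologous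
ones.

The signs come from `matchingPfaffian_toggle`. Adding a closed grid curve to `S` moves the vertices
of the Fisher graph one step along a cycle alternating between the old and the new matching. This is
a congruence of signed adjacency matrices, so the Pfaffian is multiplied by a determinant, which
splits into local factors. A face contributes 1; a row or a column contributes minus the parity sign
of the edges of `S` that meet it from one side. On homology this is the quadratic form of Arf
invariant one, with signs `+, -, -, -`.

For weights in `[0,1]` the proportion `Z₀/Z` is nonincreasing in every weight
(`sum_setWeight_mul_le`), a correlation inequality of Griffiths-Ginibre type, so `signedWeight` can
pass only from positive to negative. It equals 1 at weights 0 and is negative at weights 1, where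
`Z₀` is at most a quarter of `Z`; hence there is a zero with `0 < t < ∞`. Two zeros would make the
function vanish on the interval between them, hence for all real `t` by analyticity, contradicting
its value at `t = 0`. -/

open Matrix

/-! ### Pfaffians under congruence, and their vanishing for singular matrices. -/

section Pfaffian

variable {ι W V : Type*} [Fintype ι] [DecidableEq ι]

/-- The unnormalised Pfaffian: the sum over all permutations of the rows and columns, which for
an alternating matrix counts every perfect matching `2 ^ m * m!` times, `m` being the number of
pairs. -/
def pfaffianSum {R : Type*} [CommRing R] (A : Matrix (ι ⊕ ι) (ι ⊕ ι) R) : R :=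
  ∑ σ : Equiv.Perm (ι ⊕ ι), ((Equiv.Perm.sign σ : ℤ) : R) *
    ∏ i, A (σ (Sum.inr i)) (σ (Sum.inl i))

/-- Multilinear expansion, as for the product formula for determinants: a choice of inner indices
that is not injective contributes a determinant with two equal columns, and the injective choices
are permutations, each contributing its sign times `B.det`. -/
theorem pfaffianSum_congruence {R : Type*} [CommRing R] (A B : Matrix (ι ⊕ ι) (ι ⊕ ι) R) :
    pfaffianSum (B * A * Bᵀ) = B.det * pfaffianSum A := by
  have expand (σ : Equiv.Perm (ι ⊕ ι)) :
      ∏ i, (B * A * Bᵀ) (σ (Sum.inr i)) (σ (Sum.inl i)) =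
        ∑ f : ι ⊕ ι → ι ⊕ ι, (∏ i, A (f (Sum.inr i)) (f (Sum.inl i))) * ∏ v, B (σ v) (f v) := by
    have entry (i : ι) : (B * A * Bᵀ) (σ (Sum.inr i)) (σ (Sum.inl i)) =
        ∑ w : (ι ⊕ ι) × (ι ⊕ ι),
          A w.2 w.1 * (B (σ (Sum.inl i)) w.1 * B (σ (Sum.inr i)) w.2) := by
      simp only [Matrix.mul_apply, Matrix.transpose_apply, Finset.sum_mul,
        Fintype.sum_prod_type]
      refine Finset.sum_congr rfl fun _ _ => Finset.sum_congr rfl fun _ _ => ?_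
      ring
    simp only [entry]
    rw [Finset.prod_univ_sum, Fintype.piFinset_univ]
    refine Fintype.sum_equiv
      ((Equiv.arrowProdEquivProdArrow ι _ _).trans (Equiv.sumArrowEquivProdArrow ι ι _).symm)
      _ _ fun g => ?_
    simp [Finset.prod_mul_distrib, Fintype.prod_sum_type, Equiv.sumArrowEquivProdArrow,
      Equiv.arrowProdEquivProdArrow]
  have vanish (f : ι ⊕ ι → ι ⊕ ι) (hf : ¬ Function.Injective f) :
      (B.submatrix id f).det = 0 := by
    simp only [Function.Injective, not_forall] at hf
    obtain ⟨a, b, hab, hne⟩ := hf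
    exact Matrix.det_zero_of_column_eq hne fun k => by simp [hab]
  calc pfaffianSum (B * A * Bᵀ)
      = ∑ f : ι ⊕ ι → ι ⊕ ι, (∏ i, A (f (Sum.inr i)) (f (Sum.inl i))) *
          (B.submatrix id f).det := by
        simp only [pfaffianSum, expand, Finset.mul_sum, Matrix.det_apply']
        rw [Finset.sum_comm]
        refine Finset.sum_congr rfl fun f _ => Finset.sum_congr rfl fun σ _ => ?_
        simp only [Matrix.submatrix_apply, id]
        ring
    _ = ∑ σ : Equiv.Perm (ι ⊕ ι), (∏ i, A (σ (Sum.inr i)) (σ (Sum.inl i))) *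
          (B.submatrix id σ).det := by
        symm
        refine Finset.sum_of_injOn (fun σ => (σ : ι ⊕ ι → ι ⊕ ι))
          (fun σ _ τ _ h => Equiv.coe_fn_injective h) (fun _ _ => Finset.mem_univ _) ?_
          (fun _ _ => rfl)
        intro f _ hf
        rw [vanish f, mul_zero]
        intro hinj
        exact hf ⟨Equiv.ofBijective f (Finite.injective_iff_bijective.1 hinj), by simp, rfl⟩
    _ = B.det * pfaffianSum A := by
        simp only [pfaffianSum, Matrix.det_permute', Finset.mul_sum]
        refine Finset.sum_congr rfl fun σ _ => ?_
        ring

theorem pfaffianSum_submatrix_congruence {R : Type*} [CommRing R] [Fintype V] [DecidableEq V]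
    (r : ι ⊕ ι ≃ V) (A B : Matrix V V R) :
    pfaffianSum ((B * A * Bᵀ).submatrix r r) = B.det * pfaffianSum (A.submatrix r r) := by
  rw [← Matrix.det_submatrix_equiv_self r B, ← pfaffianSum_congruence,
    Matrix.transpose_submatrix, Matrix.submatrix_mul_equiv, Matrix.submatrix_mul_equiv]

theorem pfaffianSum_eq_zero_of_row {R : Type*} [CommRing R] {A : Matrix (ι ⊕ ι) (ι ⊕ ι) R}
    (v : ι ⊕ ι) (hrow : ∀ w, A v w = 0) (hcol : ∀ w, A w v = 0) : pfaffianSum A = 0 := by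
  refine Finset.sum_eq_zero fun σ _ => ?_
  suffices ∃ i, A (σ (Sum.inr i)) (σ (Sum.inl i)) = 0 by
    obtain ⟨i, hi⟩ := this
    rw [Finset.prod_eq_zero (Finset.mem_univ i) hi, mul_zero]
  rcases h : σ.symm v with i | i
  · exact ⟨i, by rw [← h, Equiv.apply_symm_apply, hcol]⟩
  · exact ⟨i, by rw [← h, Equiv.apply_symm_apply, hrow]⟩

/-- No cancellation occurs: a permutation with a nonzero term preserves the pairs of `J`, so after a
correction by signs its matrix is symplectic, and determinant 1 says that the term is 1. -/
theorem pfaffianSum_J_pos : 0 < pfaffianSum (Matrix.J ι ℝ) := by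
  have nonneg (σ : Equiv.Perm (ι ⊕ ι)) : 0 ≤ ((Equiv.Perm.sign σ : ℤ) : ℝ) *
      ∏ i, Matrix.J ι ℝ (σ (Sum.inr i)) (σ (Sum.inl i)) := by
    by_cases hp : ∏ i, Matrix.J ι ℝ (σ (Sum.inr i)) (σ (Sum.inl i)) = 0
    · simp [hp]
    have hne (i : ι) : Matrix.J ι ℝ (σ (Sum.inr i)) (σ (Sum.inl i)) ≠ 0 :=
      fun h => hp (Finset.prod_eq_zero (Finset.mem_univ i) h)
    -- The permutation matrix, with columns rescaled by signs, is symplectic.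
    let ψ : ι ⊕ ι → ℝ := Sum.elim
      (fun i => Matrix.J ι ℝ (σ (Sum.inr i)) (σ (Sum.inl i))) (fun _ => 1)
    let Q : Matrix (ι ⊕ ι) (ι ⊕ ι) ℝ := Matrix.diagonal ψ * (1 : Matrix _ _ ℝ).submatrix σ id
    have hQ : Q ∈ Matrix.symplecticGroup ι ℝ := by
      have conj : (1 : Matrix (ι ⊕ ι) (ι ⊕ ι) ℝ).submatrix σ id * Matrix.J ι ℝ *
          ((1 : Matrix (ι ⊕ ι) (ι ⊕ ι) ℝ).submatrix σ id)ᵀ =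
          (Matrix.J ι ℝ).submatrix σ σ := by
        ext u v
        simp [Matrix.mul_apply, Matrix.one_apply]
      rw [SymplecticGroup.mem_iff]
      have assoc : Q * Matrix.J ι ℝ * Qᵀ =
          Matrix.diagonal ψ * (Matrix.J ι ℝ).submatrix σ σ * Matrix.diagonal ψ := by
        rw [← conj]
        simp only [Q, Matrix.transpose_mul, Matrix.diagonal_transpose, Matrix.mul_assoc]
      rw [assoc]
      have sq (a b) (h : Matrix.J ι ℝ a b ≠ 0) :
          Matrix.J ι ℝ a b * Matrix.J ι ℝ a b = 1 ∧ Matrix.J ι ℝ b a = - Matrix.J ι ℝ a b ∧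
          ∀ c, c ≠ b → Matrix.J ι ℝ a c = 0 ∧ Matrix.J ι ℝ c a = 0 := by
        rcases a with a | a <;> rcases b with b | b <;>
          simp only [Matrix.J, Matrix.fromBlocks_apply₁₁, Matrix.fromBlocks_apply₁₂,
            Matrix.fromBlocks_apply₂₁, Matrix.fromBlocks_apply₂₂, Matrix.zero_apply,
            Matrix.one_apply, Matrix.neg_apply] at h ⊢
        · exact absurd rfl h
        · have : a = b := by by_contra hab; simp [hab] at h
          subst this
          refine ⟨by simp, by simp, fun c hc => ?_⟩
          rcases c with c | c
          · simp
          · have : c ≠ a := fun h => hc (h ▸ rfl)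
            simp [this, this.symm]
        · have : a = b := by by_contra hab; simp [hab] at h
          subst this
          refine ⟨by simp, by simp, fun c hc => ?_⟩
          rcases c with c | c
          · have : c ≠ a := fun h => hc (h ▸ rfl)
            simp [this, this.symm]
          · simp
        · exact absurd rfl h
      ext u v
      rw [Matrix.mul_diagonal, Matrix.diagonal_mul, Matrix.submatrix_apply]
      rcases u with i | i <;> rcases v with j | j
      · have h := sq _ _ (hne i)
        have h' := (sq (σ (Sum.inl i)) (σ (Sum.inr i)) (by rw [h.2.1]; simpa using hne i)).2.2
          (σ (Sum.inl j)) (by simp)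
        rw [h'.1, mul_zero, zero_mul]
        simp [Matrix.J]
      · have h := sq _ _ (hne i)
        by_cases hij : j = i
        · subst hij
          rw [h.2.1]
          simp [ψ, Matrix.J]
          simpa [Matrix.J] using h.1
        · have h' := (sq (σ (Sum.inl i)) (σ (Sum.inr i)) (by rw [h.2.1]; simpa using hne i)).2.2
            (σ (Sum.inr j)) (by simpa using hij)
          rw [h'.1, mul_zero, zero_mul]
          simp [Matrix.J, Ne.symm hij]
      · have h := sq _ _ (hne i)
        by_cases hij : j = i
        · subst hij
          simp [ψ, Matrix.J]
          simpa [Matrix.J] using h.1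
        · have h' := h.2.2 (σ (Sum.inl j)) (by simpa using hij)
          rw [h'.1, mul_zero, zero_mul]
          simp [Matrix.J, Ne.symm hij]
      · have h' := (sq _ _ (hne i)).2.2 (σ (Sum.inr j)) (by simp)
        rw [h'.1, mul_zero, zero_mul]
        simp [Matrix.J]
    have hdet := SymplecticGroup.det_eq_one hQ
    rw [Matrix.det_mul, Matrix.det_diagonal, Matrix.det_permute, Matrix.det_one,
      Fintype.prod_sum_type] at hdet
    simp only [ψ, Sum.elim_inl, Sum.elim_inr, Finset.prod_const_one, mul_one] at hdet
    rw [mul_comm, hdet]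
    exact zero_le_one
  refine Finset.sum_pos' (fun σ _ => nonneg σ) ⟨1, Finset.mem_univ _, ?_⟩
  simp [Matrix.J]

/-- Symplectic Gram-Schmidt, one hyperbolic pair at a time: a dimension count gives a nonzero vector
orthogonal to the pairs already found, and nondegeneracy gives it a partner. -/
theorem exists_symplectic_family {E : Type*} [AddCommGroup E] [Module ℝ E] [FiniteDimensional ℝ E]
    (ω : LinearMap.BilinForm ℝ E) (halt : ω.IsAlt) (hnd : ∀ v, (∀ w, ω v w = 0) → v = 0)
    (k : ℕ) (hk : 2 * k ≤ Module.finrank ℝ E) :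
    ∃ e f : Fin k → E, (∀ i j, ω (e i) (e j) = 0) ∧ (∀ i j, ω (f i) (f j) = 0) ∧
      ∀ i j, ω (e i) (f j) = if i = j then 1 else 0 := by
  induction k with
  | zero => exact ⟨Fin.elim0, Fin.elim0, fun i => i.elim0, fun i => i.elim0, fun i => i.elim0⟩
  | succ k ih =>
    obtain ⟨e, f, hee, hff, hef⟩ := ih (by omega)
    have hfe (i j) : ω (f i) (e j) = - if i = j then 1 else 0 := by
      rw [← LinearMap.BilinForm.IsAlt.neg_eq halt, hef]
      simp [eq_comm]
    obtain ⟨v, hve, hvf, hv⟩ : ∃ v, (∀ i, ω v (e i) = 0) ∧ (∀ i, ω v (f i) = 0) ∧ v ≠ 0 := by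
      let Φ : E →ₗ[ℝ] (Fin k ⊕ Fin k → ℝ) := LinearMap.pi (Sum.elim
        (fun i => ω.flip (e i)) (fun i => ω.flip (f i)))
      have hker : Φ.ker ≠ ⊥ := LinearMap.ker_ne_bot_of_finrank_lt (by simp; omega)
      obtain ⟨v, hv, hv0⟩ := (Submodule.ne_bot_iff _).1 hker
      rw [LinearMap.mem_ker] at hv
      exact ⟨v, fun i => congrFun hv (Sum.inl i), fun i => congrFun hv (Sum.inr i), hv0⟩
    obtain ⟨u, hu⟩ : ∃ u, ω v u = 1 := by
      obtain ⟨u, hu⟩ := not_forall.1 (mt (hnd v) hv)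
      exact ⟨(ω v u)⁻¹ • u, by simp [hu]⟩
    -- Projection of `u` off the span of the earlier pairs. The two sums have opposite signs because
    -- `ω (e i) (f i) = 1` and `ω (f i) (e i) = -1`.
    let w := u - ∑ i, ω u (f i) • e i + ∑ i, ω u (e i) • f i
    have hwe (j) : ω w (e j) = 0 := by simp [w, hee, hfe]
    have hwf (j) : ω w (f j) = 0 := by simp [w, hff, hef]
    have hvw : ω v w = 1 := by simp [w, hve, hvf, hu]
    have hev (i) : ω (e i) v = 0 := by rw [← LinearMap.BilinForm.IsAlt.neg_eq halt, hve, neg_zero]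
    have hfw (i) : ω (f i) w = 0 := by rw [← LinearMap.BilinForm.IsAlt.neg_eq halt, hwf, neg_zero]
    have hew (i) : ω (e i) w = 0 := by rw [← LinearMap.BilinForm.IsAlt.neg_eq halt, hwe, neg_zero]
    refine ⟨Fin.cons v e, Fin.cons w f, fun i j => ?_, fun i j => ?_, fun i j => ?_⟩ <;>
      refine Fin.cases ?_ (fun i => ?_) i <;> refine Fin.cases ?_ (fun j => ?_) j <;>
      simp [hee, hff, hef, hve, hvf, hvw, hwf, hev, hew, hfw, halt.self_eq_zero,
        Fin.succ_ne_zero, (Fin.succ_ne_zero _).symm]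

theorem exists_congruence_J {m : ℕ} (A : Matrix (Fin m ⊕ Fin m) (Fin m ⊕ Fin m) ℝ)
    (hA : Aᵀ = -A) (hdet : A.det ≠ 0) :
    ∃ B : Matrix (Fin m ⊕ Fin m) (Fin m ⊕ Fin m) ℝ, B * A * Bᵀ = Matrix.J (Fin m) ℝ := by
  have neg (v w : Fin m ⊕ Fin m → ℝ) : v ⬝ᵥ A *ᵥ w = -(w ⬝ᵥ A *ᵥ v) := by
    rw [Matrix.dotProduct_mulVec, ← Matrix.mulVec_transpose, hA, Matrix.neg_mulVec,
      neg_dotProduct, dotProduct_comm]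
  obtain ⟨e, f, hee, hff, hef⟩ := exists_symplectic_family (Matrix.toBilin' A)
    (fun v => by
      have := neg v v
      rw [Matrix.toBilin'_apply']
      linarith)
    (fun v hv => by
      by_contra hv0
      have hker : v ᵥ* A = 0 := by
        ext j
        have := hv (Pi.single j 1)
        rw [Matrix.toBilin'_apply', Matrix.dotProduct_mulVec] at this
        simpa using this
      exact hdet (Matrix.exists_vecMul_eq_zero_iff.1 ⟨v, hv0, hker⟩))
    m (by simp; omega)
  have entry (B : Matrix (Fin m ⊕ Fin m) (Fin m ⊕ Fin m) ℝ) (u v) :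
      (B * A * Bᵀ) u v = B u ⬝ᵥ A *ᵥ B v := by
    rw [Matrix.mul_apply_eq_vecMul, Matrix.dotProduct_mulVec]
    rfl
  simp only [Matrix.toBilin'_apply'] at hee hff hef
  -- The `f` rows come first because `J` has `-1` in its upper right block.
  refine ⟨Matrix.of (Sum.elim f e), ?_⟩
  ext u v
  rw [entry]
  rcases u with i | i <;> rcases v with j | j
  · change f i ⬝ᵥ A *ᵥ f j = _
    simp [Matrix.J, hff]
  · change f i ⬝ᵥ A *ᵥ e j = _
    rw [neg, hef]
    simp [Matrix.J, Matrix.one_apply, eq_comm]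
  · change e i ⬝ᵥ A *ᵥ f j = _
    simp [Matrix.J, hef, Matrix.one_apply]
  · change e i ⬝ᵥ A *ᵥ e j = _
    simp [Matrix.J, hee]

/-- An alternating matrix is singular if and only if its Pfaffian vanishes. -/
theorem pfaffianSum_eq_zero_iff {m : ℕ} [Fintype V] [DecidableEq V] (r : Fin m ⊕ Fin m ≃ V)
    (A : Matrix V V ℝ) (hA : Aᵀ = -A) :
    pfaffianSum (A.submatrix r r) = 0 ↔ A.det = 0 := by
  rw [← Matrix.det_submatrix_equiv_self r A]
  have hM : (A.submatrix r r)ᵀ = -A.submatrix r r := by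
    rw [Matrix.transpose_submatrix, hA]
    rfl
  generalize A.submatrix r r = M at hM
  constructor
  · intro hpf
    by_contra hdet
    obtain ⟨B, hB⟩ := exists_congruence_J M hM hdet
    have := pfaffianSum_congruence M B
    rw [hB, hpf, mul_zero] at this
    exact pfaffianSum_J_pos.ne' this
  · intro hdet
    obtain ⟨v, hv0, hv⟩ := Matrix.exists_vecMul_eq_zero_iff.2 hdet
    obtain ⟨i, hi⟩ := Function.ne_iff.1 hv0
    have hv' : M *ᵥ v = 0 := by
      rw [← Matrix.vecMul_transpose, hM, Matrix.vecMul_neg, hv, neg_zero]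
    -- Replacing row and column `i` by the kernel vector is an invertible congruence.
    let B : Matrix (Fin m ⊕ Fin m) (Fin m ⊕ Fin m) ℝ := (1 : Matrix _ _ ℝ).updateRow i v
    have hBdet : B.det = v i := by
      have hsum : v = ∑ k, v k • (1 : Matrix (Fin m ⊕ Fin m) (Fin m ⊕ Fin m) ℝ) k := by
        ext j
        simp [Finset.sum_apply, Matrix.one_apply, -Fintype.sum_sum_type]
      have := Matrix.det_updateRow_sum (1 : Matrix (Fin m ⊕ Fin m) (Fin m ⊕ Fin m) ℝ) i v
      rw [← hsum] at this
      simpa using this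
    have hBi : B i = v := by simp [B]
    have hzero : pfaffianSum (B * M * Bᵀ) = 0 := by
      refine pfaffianSum_eq_zero_of_row i (fun w => ?_) (fun w => ?_)
      · rw [Matrix.mul_apply_eq_vecMul, Matrix.mul_apply_eq_vecMul, hBi, hv]
        simp
      · rw [Matrix.mul_assoc, Matrix.mul_apply]
        have hcol (k : Fin m ⊕ Fin m) : (M * Bᵀ) k i = (M *ᵥ v) k := by
          rw [← hBi]
          rfl
        simp only [hcol, hv', Pi.zero_apply, mul_zero, Finset.sum_const_zero]
    rw [pfaffianSum_congruence, hBdet] at hzero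
    exact (mul_eq_zero.1 hzero).resolve_left hi

end Pfaffian

/-! ### Pfaffians of single matchings, and the expansion over all perfect matchings. -/

section Matchings

variable {V R : Type*} [DecidableEq V] [CommRing R]

/-- The signed adjacency matrix of the matching that pairs `u` with `τ u`. -/
def matchingMatrix (ε : V → V → R) (τ : V → V) : Matrix V V R :=
  fun u v => if v = τ u then ε u v else 0

/-- The sign of the step from `u` to `π u`, fixed points counting as `1`. -/
def stepSign (ε : V → V → R) (π : Equiv.Perm V) (u : V) : R :=
  if π u = u then 1 else ε u (π u)

/-- If the permutation `π` rotates each of its cycles by one step along edges alternating between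
two perfect matchings, then it changes the Pfaffian by its own sign times the signs of the steps. -/
theorem pfaffianSum_matchingMatrix_rotate {ι : Type*} [Fintype ι] [DecidableEq ι] [Fintype V]
    (r : ι ⊕ ι ≃ V) {ε : V → V → R} (skew : ∀ u v, ε v u = -ε u v) {τ τ' : V → V}
    (π : Equiv.Perm V)
    (conj : ∀ u, τ' (π u) = π (τ u))
    (alternate : ∀ u, π u = τ u ∨ π (τ u) = u ∨ (π u = u ∧ π (τ u) = τ u))
    (unit : ∀ u, π u ≠ u → ε u (π u) * ε u (π u) = 1) :
    pfaffianSum ((matchingMatrix ε τ').submatrix r r) =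
      (((Equiv.Perm.sign π : ℤ) : R) * ∏ u, stepSign ε π u) *
        pfaffianSum ((matchingMatrix ε τ).submatrix r r) := by
  let P : Matrix V V R := (1 : Matrix V V R).submatrix π.symm id
  let Q : Matrix V V R := P * Matrix.diagonal (stepSign ε π)
  have hdet : Q.det = ((Equiv.Perm.sign π : ℤ) : R) * ∏ u, stepSign ε π u := by
    rw [Matrix.det_mul, Matrix.det_diagonal, Matrix.det_permute, Matrix.det_one, mul_one,
      Equiv.Perm.sign_symm]
  -- The edge from `u` to `τ u` is carried to the edge from `π u` to `π (τ u)`. If `π` moves `u`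
  -- along its matching edge or `τ u` along it, that edge sign occurs twice and squares to 1,
  -- leaving the sign of the new edge.
  have step (u : V) : ε (π u) (π (τ u)) = stepSign ε π u * ε u (τ u) * stepSign ε π (τ u) := by
    unfold stepSign
    by_cases hu : π u = u
    · rcases alternate u with h | h | ⟨-, h⟩
      · have : τ u = u := by rw [← h, hu]
        simp [hu, this]
      · have : τ u = u := π.injective (by rw [h, hu])
        simp [hu, this]
      · simp [hu, h]
    · rcases alternate u with h | h | ⟨h, -⟩
      · have h1 := unit u hu
        rw [← h] at *
        have h2 : π (π u) ≠ π u := fun h' => hu (π.injective h')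
        rw [if_neg hu, if_neg h2, h1, one_mul]
      · have h2 : τ u ≠ u := fun h' => hu (by rwa [h'] at h)
        have h1 := unit (τ u) (by rw [h]; exact h2.symm)
        rw [h] at h1
        rw [h, if_neg hu, if_neg h2.symm, skew (τ u) u, skew u (π u)]
        linear_combination ε u (π u) * h1
      · exact absurd h hu
  have hQ : Q * matchingMatrix ε τ * Qᵀ = matchingMatrix ε τ' := by
    have hP : Q * matchingMatrix ε τ * Qᵀ =
        (Matrix.diagonal (stepSign ε π) * matchingMatrix ε τ *
          Matrix.diagonal (stepSign ε π)).submatrix π.symm π.symm := by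
      have (M : Matrix V V R) : P * M * Pᵀ = M.submatrix π.symm π.symm := by
        ext u v
        simp [P, Matrix.mul_apply, Matrix.one_apply]
      rw [← this]
      simp only [Q, Matrix.transpose_mul, Matrix.diagonal_transpose, Matrix.mul_assoc]
    rw [hP]
    ext u v
    obtain ⟨u, rfl⟩ := π.surjective u
    obtain ⟨v, rfl⟩ := π.surjective v
    rw [Matrix.submatrix_apply, Equiv.symm_apply_apply, Equiv.symm_apply_apply,
      Matrix.mul_diagonal, Matrix.diagonal_mul, matchingMatrix, matchingMatrix, conj]
    by_cases h : v = τ u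
    · subst h
      simp [step]
    · simp [h, π.injective.eq_iff]
  rw [← hQ, pfaffianSum_submatrix_congruence, hdet]

/-- A signed permutation matrix is orthogonal. -/
theorem det_matchingMatrix_ne_zero [Fintype V] [Nontrivial R] {ε : V → V → R} {τ : V → V}
    (hτ : Function.Injective τ) (unit : ∀ u, ε u (τ u) * ε u (τ u) = 1) :
    (matchingMatrix ε τ).det ≠ 0 := by
  have h : matchingMatrix ε τ * (matchingMatrix ε τ)ᵀ = 1 := by
    ext u v
    rw [Matrix.mul_apply, Finset.sum_eq_single (τ u)]
    · by_cases huv : u = v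
      · subst huv
        simp [matchingMatrix, unit]
      · simp [matchingMatrix, huv, hτ.eq_iff]
    · intro w _ hw
      simp [matchingMatrix, hw]
    · simp
  intro h0
  have := congrArg Matrix.det h
  rw [Matrix.det_mul, h0, zero_mul, Matrix.det_one] at this
  exact zero_ne_one this

theorem transpose_matchingMatrix {ε : V → V → R} (skew : ∀ u v, ε v u = -ε u v) {τ : V → V}
    (hτ : Function.Involutive τ) : (matchingMatrix ε τ)ᵀ = -matchingMatrix ε τ := by
  ext u v
  simp only [Matrix.transpose_apply, matchingMatrix, Matrix.neg_apply]
  have : u = τ v ↔ v = τ u := ⟨fun h => by rw [h, hτ], fun h => by rw [h, hτ]⟩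
  by_cases h : v = τ u
  · rw [if_pos (this.2 h), if_pos h, skew u v]
  · rw [if_neg (mt this.1 h), if_neg h, neg_zero]

/-- The expansion of a Pfaffian over the perfect matchings of a weighted graph: `ε` holds the signs,
`w` the weights of the edges, and `τ` enumerates the perfect matchings. -/
theorem pfaffianSum_eq_sum_matchings {ι : Type*} [Fintype ι] [DecidableEq ι] [Fintype V]
    (r : ι ⊕ ι ≃ V) (K : Matrix V V R) {ε w : V → V → R} (hK : ∀ u v, K u v = w u v * ε u v)
    {𝒮 : Type*} (C : Finset 𝒮) (τ : 𝒮 → V → V)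
    (ω : 𝒮 → V → R) (skew : ∀ u v, ε v u = -ε u v)
    (inj : ∀ S ∈ C, ∀ T ∈ C, τ S = τ T → S = T)
    (exhaust : ∀ t : V → V, Function.Involutive t → (∀ u, t u ≠ u) → (∀ u, ε u (t u) ≠ 0) →
      ∃ S ∈ C, τ S = t)
    (involutive : ∀ S ∈ C, Function.Involutive (τ S))
    (weight : ∀ S ∈ C, ∀ u, w u (τ S u) = ω S u * ω S (τ S u)) :
    pfaffianSum (K.submatrix r r) =
      ∑ S ∈ C, (∏ v, ω S v) * pfaffianSum ((matchingMatrix ε (τ S)).submatrix r r) := by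
  -- Since the pairs of `σ` use every vertex once, a weight distributed over the vertices has the
  -- same product for all `σ`.
  have cover (σ : Equiv.Perm (ι ⊕ ι)) (φ : V → R) :
      ∏ i, (φ (r (σ (Sum.inr i))) * φ (r (σ (Sum.inl i)))) = ∏ v, φ v := by
    rw [← Equiv.prod_comp r, ← Equiv.prod_comp σ, Fintype.prod_sum_type, Finset.prod_mul_distrib,
      mul_comm]
  have term (σ : Equiv.Perm (ι ⊕ ι)) :
      ∏ i, K (r (σ (Sum.inr i))) (r (σ (Sum.inl i))) =
        ∑ S ∈ C, (∏ v, ω S v) *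
          ∏ i, matchingMatrix ε (τ S) (r (σ (Sum.inr i))) (r (σ (Sum.inl i))) := by
    simp only [hK]
    -- The involution that exchanges the two members of every pair.
    let t : V → V := fun v => r (σ (σ.symm (r.symm v)).swap)
    have ht : Function.Involutive t := fun v => by simp [t]
    have htr (i : ι) : t (r (σ (Sum.inr i))) = r (σ (Sum.inl i)) := by simp [t]
    have htl (i : ι) : t (r (σ (Sum.inl i))) = r (σ (Sum.inr i)) := by simp [t]
    have pairs (p : V → Prop) (hr : ∀ i, p (r (σ (Sum.inr i)))) (hl : ∀ i, p (r (σ (Sum.inl i))))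
        (v : V) : p v := by
      obtain ⟨i, rfl⟩ := (σ.trans r).surjective v
      rcases i with i | i
      exacts [hl i, hr i]
    have fit (S) (hS : S ∈ C) (h : τ S ≠ t) :
        ∏ i, matchingMatrix ε (τ S) (r (σ (Sum.inr i))) (r (σ (Sum.inl i))) = 0 := by
      by_contra hne
      refine h (funext (pairs _ (fun i => ?_) (fun i => ?_)))
      · rw [htr]
        by_contra hi
        exact hne (Finset.prod_eq_zero (Finset.mem_univ i) (if_neg (Ne.symm hi)))
      · rw [htl]
        by_contra hi
        refine hne (Finset.prod_eq_zero (Finset.mem_univ i) (if_neg fun h' => hi ?_))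
        rw [h', involutive S hS]
    -- If every pair of `σ` is an edge, exactly one matching contributes; otherwise both sides
    -- vanish.
    by_cases hε : ∀ u, ε u (t u) ≠ 0
    · have hfix (v : V) : t v ≠ v := by
        obtain ⟨i, rfl⟩ := (σ.trans r).surjective v
        rcases i with i | i
        · change t (r (σ (Sum.inl i))) ≠ r (σ (Sum.inl i))
          rw [htl]; simp
        · change t (r (σ (Sum.inr i))) ≠ r (σ (Sum.inr i))
          rw [htr]; simp
      obtain ⟨S, hS, hSt⟩ := exhaust t ht hfix hε
      rw [Finset.sum_eq_single S]
      · rw [Finset.prod_mul_distrib, ← cover σ]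
        congr 1
        · refine Finset.prod_congr rfl fun i _ => ?_
          rw [← htr, ← hSt, weight S hS]
        · refine Finset.prod_congr rfl fun i _ => ?_
          rw [matchingMatrix, hSt, htr, if_pos rfl]
      · intro T hT hTS
        rw [fit T hT (fun h => hTS (inj T hT S hS (h.trans hSt.symm))), mul_zero]
      · exact fun h => absurd hS h
    · obtain ⟨i, hi⟩ : ∃ i, ε (r (σ (Sum.inr i))) (r (σ (Sum.inl i))) = 0 := by
        by_contra! hne
        refine hε (pairs _ (fun i => ?_) (fun i => ?_))
        · rw [htr]
          exact hne i
        · rw [htl, skew, neg_ne_zero]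
          exact hne i
      rw [Finset.prod_eq_zero (Finset.mem_univ i) (by rw [hi, mul_zero])]
      symm
      refine Finset.sum_eq_zero fun S hS => ?_
      rw [Finset.prod_eq_zero (Finset.mem_univ i) (by simp [matchingMatrix, hi]), mul_zero]
  simp only [pfaffianSum, Finset.mul_sum]
  rw [Finset.sum_comm]
  refine Finset.sum_congr rfl fun σ _ => ?_
  simp only [Matrix.submatrix_apply, term, Finset.mul_sum]
  refine Finset.sum_congr rfl fun S _ => ?_
  ring

end Matchings

/-! ### The Kasteleyn matrix at `z = w = 1` as a real antisymmetric matrix. -/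

section FisherGraph

variable {n : ℕ}

/-- The other end of the square-grid edge at a corner of a gadget. -/
def externalMate : FisherVertex n → FisherVertex n
  | (p, .west) => ((p.1 - 1, p.2), .east)
  | (p, .south) => ((p.1, p.2 - 1), .north)
  | (p, .east) => ((p.1 + 1, p.2), .west)
  | (p, .north) => ((p.1, p.2 + 1), .south)
  | (p, .inner) => (p, .inner)
  | (p, .outer) => (p, .outer)

/-- The value of a function of the grid edges at the edge that ends in a corner of a gadget, and
the default value `d` at the other vertices of the gadget. -/
def halfEdge {α : Type*} (d : α) (x : GridEdge n → α) : FisherVertex n → α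
  | (p, .west) => x ((p.1 - 1, p.2), .right)
  | (p, .south) => x ((p.1, p.2 - 1), .up)
  | (p, .east) => x (p, .right)
  | (p, .north) => x (p, .up)
  | (_, .inner) => d
  | (_, .outer) => d

/-- The sign of a class of edges relative to its reference direction. -/
def classSign (o : FisherOrientation) (c : EdgeClass) : ℝ := if o c then 1 else -1

/-- The signs of the edges inside a gadget. -/
def gadgetSign (o : FisherOrientation) : GadgetVertex → GadgetVertex → ℝ
  | .west, .inner => classSign o .westInner
  | .inner, .west => -classSign o .westInner
  | .inner, .south => classSign o .innerSouth
  | .south, .inner => -classSign o .innerSouth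
  | .south, .west => classSign o .southWest
  | .west, .south => -classSign o .southWest
  | .east, .outer => classSign o .eastOuter
  | .outer, .east => -classSign o .eastOuter
  | .outer, .north => classSign o .outerNorth
  | .north, .outer => -classSign o .outerNorth
  | .north, .east => classSign o .northEast
  | .east, .north => -classSign o .northEast
  | .inner, .outer => classSign o .aEdge
  | .outer, .inner => -classSign o .aEdge
  | _, _ => 0

/-- The signs of the square-grid edges, traversed starting from a corner of a gadget. -/
def externalSign (o : FisherOrientation) : GadgetVertex → ℝ
  | .east => classSign o .horizontal
  | .west => -classSign o .horizontal
  | .north => classSign o .vertical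
  | .south => -classSign o .vertical
  | .inner => 0
  | .outer => 0

/-- The signed adjacency function of the Fisher graph. -/
def fisherSign (o : FisherOrientation) (u v : FisherVertex n) : ℝ :=
  (if v.1 = u.1 then gadgetSign o u.2 v.2 else 0) +
    if v = externalMate u then externalSign o u.2 else 0

/-- The weights of pairs of adjacent vertices of the Fisher graph. -/
def pairWeight (x : GridEdge n → ℝ) (u v : FisherVertex n) : ℝ :=
  if v = externalMate u then halfEdge 1 x u else 1

theorem externalMate_involutive : Function.Involutive (externalMate (n := n)) := by
  rintro ⟨p, a⟩
  cases a <;> simp [externalMate]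

theorem halfEdge_externalMate {α : Type*} (d : α) (x : GridEdge n → α) (u : FisherVertex n) :
    halfEdge d x (externalMate u) = halfEdge d x u := by
  rcases u with ⟨p, a⟩
  cases a <;> simp [externalMate, halfEdge]

theorem fisherSign_skew (o : FisherOrientation) (u v : FisherVertex n) :
    fisherSign o v u = -fisherSign o u v := by
  have inside (a b : GadgetVertex) : gadgetSign o b a = -gadgetSign o a b := by
    cases a <;> cases b <;> simp [gadgetSign]
  have outside (w : FisherVertex n) : externalSign o (externalMate w).2 = -externalSign o w.2 := by
    rcases w with ⟨p, a⟩
    cases a <;> simp [externalMate, externalSign]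
  have hmate : u = externalMate v ↔ v = externalMate u :=
    ⟨fun h => by rw [h, externalMate_involutive], fun h => by rw [h, externalMate_involutive]⟩
  unfold fisherSign
  by_cases h : v = externalMate u
  · rw [if_pos (hmate.2 h), if_pos h, h, outside]
    by_cases h' : (externalMate u).1 = u.1
    · rw [if_pos h'.symm, if_pos h', inside]
      ring
    · rw [if_neg (Ne.symm h'), if_neg h']
      ring
  · rw [if_neg (mt hmate.1 h), if_neg h]
    by_cases h' : v.1 = u.1
    · rw [if_pos h'.symm, if_pos h', inside]
      ring
    · rw [if_neg (Ne.symm h'), if_neg h']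
      ring

/-- The real Kasteleyn matrix `K(1, 1)`. -/
noncomputable def realKasteleyn (o : FisherOrientation) (x : GridEdge n → ℝ) :
    Matrix (FisherVertex n) (FisherVertex n) ℝ :=
  Matrix.of fun u v => pairWeight x u v * fisherSign o u v

theorem kasteleynMatrix_one_one [NeZero n] (o : FisherOrientation) (x : GridEdge n → ℝ) :
    kasteleynMatrix o x 1 1 = (realKasteleyn o x).map Complex.ofReal := by
  -- Reversing an edge negates its contribution, so an orientation acts only through the sign of the
  -- class.
  have orient (e : FisherEdge n) (u v : FisherVertex n) (W : ℂ) :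
      ((if o.tail e = u ∧ o.head e = v then W else 0) -
        (if o.tail e = v ∧ o.head e = u then W else 0)) =
      (classSign o e.2 : ℂ) * ((if edgeStart e = u ∧ edgeEnd e = v then W else 0) -
        (if edgeStart e = v ∧ edgeEnd e = u then W else 0)) := by
    unfold FisherOrientation.tail FisherOrientation.head classSign
    cases o e.2
    · simp only [Bool.false_eq_true, if_false, and_comm]
      push_cast
      ring
    · simp
  have univ_class : (Finset.univ : Finset EdgeClass) = {.westInner, .innerSouth, .southWest,
    .eastOuter, .outerNorth, .northEast, .aEdge, .horizontal, .vertical} := rfl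
  have edge_sum (c : EdgeClass) (a b : GadgetVertex) (φ : TorusCell n → TorusCell n)
      (W : TorusCell n → ℝ) (hstart : ∀ p : TorusCell n, edgeStart (p, c) = (p, a))
      (hend : ∀ p, edgeEnd (p, c) = (φ p, b)) (hW : ∀ p, fisherWeight x (p, c) = W p)
      (u v : FisherVertex n) :
      ∑ p, (classSign o c : ℂ) * ((if edgeStart (p, c) = u ∧ edgeEnd (p, c) = v then
            (fisherWeight x (p, c) : ℂ) else 0) -
          (if edgeStart (p, c) = v ∧ edgeEnd (p, c) = u then
            (fisherWeight x (p, c) : ℂ) else 0)) =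
        ((classSign o c * ((if u.2 = a ∧ v = (φ u.1, b) then W u.1 else 0) -
          (if v.2 = a ∧ u = (φ v.1, b) then W v.1 else 0)) : ℝ) : ℂ) := by
    have single (u v : FisherVertex n) :
        ∑ p, (if edgeStart (p, c) = u ∧ edgeEnd (p, c) = v then
            (fisherWeight x (p, c) : ℂ) else 0) =
          ((if u.2 = a ∧ v = (φ u.1, b) then W u.1 else 0 : ℝ) : ℂ) := by
      rw [Finset.sum_eq_single u.1]
      · have : (edgeStart (u.1, c) = u ∧ edgeEnd (u.1, c) = v) ↔
            (u.2 = a ∧ v = (φ u.1, b)) := by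
          rw [hstart, hend, Prod.ext_iff, eq_comm (b := v)]
          simp [eq_comm]
        simp only [this, hW]
        split_ifs <;> simp
      · intro p _ hp
        rw [if_neg]
        rintro ⟨h, -⟩
        rw [hstart] at h
        exact hp (congrArg Prod.fst h)
      · simp
    rw [← Finset.mul_sum, Finset.sum_sub_distrib, single, single]
    push_cast
    rfl
  ext u v
  rw [Matrix.map_apply, realKasteleyn, Matrix.of_apply, kasteleynMatrix]
  simp only [crossingFactor, ite_self, mul_one, inv_one, orient]
  rw [Fintype.sum_prod_type_right, univ_class]
  iterate 8 rw [Finset.sum_insert (by decide)]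
  rw [Finset.sum_singleton]
  have inside (c : EdgeClass) (a b : GadgetVertex) hstart hend hW :=
    edge_sum c a b id (fun _ => 1) hstart hend hW u v
  rw [inside .westInner .west .inner (fun _ => rfl) (fun _ => rfl) (fun _ => rfl),
    inside .innerSouth .inner .south (fun _ => rfl) (fun _ => rfl) (fun _ => rfl),
    inside .southWest .south .west (fun _ => rfl) (fun _ => rfl) (fun _ => rfl),
    inside .eastOuter .east .outer (fun _ => rfl) (fun _ => rfl) (fun _ => rfl),
    inside .outerNorth .outer .north (fun _ => rfl) (fun _ => rfl) (fun _ => rfl),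
    inside .northEast .north .east (fun _ => rfl) (fun _ => rfl) (fun _ => rfl),
    inside .aEdge .inner .outer (fun _ => rfl) (fun _ => rfl) (fun _ => rfl),
    edge_sum .horizontal .east .west (fun p => (p.1 + 1, p.2)) (fun p => x (p, .right))
      (fun _ => rfl) (fun _ => rfl) (fun _ => rfl) u v,
    edge_sum .vertical .north .south (fun p => (p.1, p.2 + 1)) (fun p => x (p, .up))
      (fun _ => rfl) (fun _ => rfl) (fun _ => rfl) u v]
  simp only [← Complex.ofReal_add, id]
  congr 1
  rcases u with ⟨p, a⟩
  rcases v with ⟨q, b⟩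
  have hR : p = (q.1 + 1, q.2) ↔ q = (p.1 - 1, p.2) := by
    constructor <;> rintro rfl <;> simp
  have hU : p = (q.1, q.2 + 1) ↔ q = (p.1, p.2 - 1) := by
    constructor <;> rintro rfl <;> simp
  have hpq : p = q ↔ q = p := eq_comm
  cases a <;> cases b <;>
    simp only [pairWeight, fisherSign, gadgetSign, externalSign, externalMate, halfEdge,
      Prod.mk.injEq, reduceCtorEq, and_true, and_false, true_and, false_and, if_false, hR, hU, hpq,
      sub_zero, zero_sub, add_zero, zero_add, mul_zero, ite_self, one_mul] <;>
    split_ifs with h <;> simp [h, mul_comm]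

end FisherGraph

/-! ### Finite checks inside one gadget: matchings, alternating paths and their signs. -/

section Gadget

/-- The indicator of a set of square-grid edges at one vertex, as a function on its gadget. -/
def cornerBits (w s e n : ZMod 2) : GadgetVertex → ZMod 2
  | .west => w
  | .south => s
  | .east => e
  | .north => n
  | .inner => 0
  | .outer => 0

theorem eq_cornerBits {c : GadgetVertex → ZMod 2} (hi : c .inner = 0) (ho : c .outer = 0) :
    c = cornerBits (c .west) (c .south) (c .east) (c .north) := by
  funext x
  cases x <;> simp [cornerBits, hi, ho]

/-- The pairing, within a gadget, of the vertices that are not covered by square-grid edges. -/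
def localMate (c : GadgetVertex → ZMod 2) : GadgetVertex → GadgetVertex
  | .west => if c .south = 0 then .south else .inner
  | .south => if c .west = 0 then .west else .inner
  -- For even bits, `c .west = c .south` holds exactly when `c .east = c .north`, so both triangles
  -- agree on the use of the `a`-edge. The values of this function matter only at vertices with bit
  -- 0.
  | .inner => if c .west = c .south then .outer else if c .west = 1 then .south else .west
  | .east => if c .north = 0 then .north else .outer
  | .north => if c .east = 0 then .east else .outer
  | .outer => if c .east = c .north then .inner else if c .east = 1 then .north else .east

/-- The ways in which a closed curve along the square grid may pass a vertex. -/
inductive Passage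
  | eastNorth | southEast | westSouth | northWest | westEast | southNorth
  deriving DecidableEq

instance : Fintype Passage where
  elems := {.eastNorth, .southEast, .westSouth, .northWest, .westEast, .southNorth}
  complete a := by cases a <;> decide

/-- The corner of the gadget where a passage enters. -/
def Passage.entry : Passage → GadgetVertex
  | .eastNorth => .east
  | .southEast => .south
  | .westSouth => .west
  | .northWest => .north
  | .westEast => .west
  | .southNorth => .south

/-- The corner of the gadget where a passage leaves. -/
def Passage.exit : Passage → GadgetVertex
  | .eastNorth => .north
  | .southEast => .east
  | .westSouth => .south
  | .northWest => .west
  | .westEast => .east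
  | .southNorth => .north

/-- The alternating path inside the gadget along which a passage changes the matching. -/
def Passage.path (t : Passage) (c : GadgetVertex → ZMod 2) : List GadgetVertex :=
  match t with
  -- Whenever a path crosses a triangle between two of its vertices, the third vertex is visited
  -- exactly if its partner, before and after, lies in that triangle.
  | .eastNorth => .east :: if c .west = c .south then [.north] else [.outer, .north]
  | .southEast => .south :: if c .west = 0 then
      .west :: .inner :: .outer :: if c .north = 0 then [.north, .east] else [.east] else
      .inner :: .outer :: if c .north = 0 then [.north, .east] else [.east]
  | .westSouth => .west :: if c .east = c .north then [.south] else [.inner, .south]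
  | .northWest => .north :: if c .east = 0 then
      .east :: .outer :: .inner :: if c .south = 0 then [.south, .west] else [.west] else
      .outer :: .inner :: if c .south = 0 then [.south, .west] else [.west]
  | .westEast => .west :: if c .south = 0 then
      .south :: .inner :: .outer :: if c .north = 0 then [.north, .east] else [.east] else
      .inner :: .outer :: if c .north = 0 then [.north, .east] else [.east]
  | .southNorth => .south :: if c .west = 0 then
      .west :: .inner :: .outer :: if c .east = 0 then [.east, .north] else [.north] else
      .inner :: .outer :: if c .east = 0 then [.east, .north] else [.north]

/-- The permutation that rotates the alternating path of a passage by one step. -/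
def Passage.rotation (t : Passage) (c : GadgetVertex → ZMod 2) : Equiv.Perm GadgetVertex :=
  (t.path c).formPerm

/-- The indicator at a vertex after a passage has been added. -/
def Passage.toggle (t : Passage) (c : GadgetVertex → ZMod 2) (x : GadgetVertex) : ZMod 2 :=
  if x = t.entry ∨ x = t.exit then c x + 1 else c x

/-- How the rotation of a passage relates the pairings before and after, at a vertex `x` that is
paired inside the gadget and is not the exit. -/
def Passage.Alternates (t : Passage) (c : GadgetVertex → ZMod 2) (x : GadgetVertex) : Prop :=
  (t.rotation c x = localMate c x ∧ (localMate c x = t.exit → c t.exit = 0) ∧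
      (localMate c x ≠ t.exit → t.toggle c (localMate c x) = 0 ∧
        localMate (t.toggle c) (localMate c x) = t.rotation c (localMate c x))) ∨
    (localMate c x ≠ t.exit ∧ t.rotation c (localMate c x) = x ∧
      t.toggle c (t.rotation c x) = 0 ∧ localMate (t.toggle c) (t.rotation c x) = x) ∨
    (t.rotation c x = x ∧ localMate c x ≠ t.exit ∧ t.rotation c (localMate c x) = localMate c x ∧
      t.toggle c x = 0 ∧ localMate (t.toggle c) x = localMate c x)

instance (t : Passage) (c : GadgetVertex → ZMod 2) (x : GadgetVertex) :
    Decidable (t.Alternates c x) := by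
  unfold Passage.Alternates
  infer_instance

/-- The pairing inside a gadget, away from the entry and the exit, before and after. -/
structure Passage.Compatible (t : Passage) (c : GadgetVertex → ZMod 2) : Prop where
  exit_to_entry : t.rotation c t.exit = t.entry
  fixed : ∀ x, c x = 1 → x ≠ t.entry → x ≠ t.exit → t.rotation c x = x
  entry_covered : c t.entry = 1 → localMate (t.toggle c) t.entry = t.rotation c t.entry
  entry_covered' : c t.entry = 1 → t.toggle c (t.rotation c t.entry) = 0 ∧
    localMate (t.toggle c) (t.rotation c t.entry) = t.entry
  exit_free : c t.exit = 0 → localMate c t.exit ≠ t.exit ∧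
    t.rotation c (localMate c t.exit) = t.exit
  alternates : ∀ x, x ≠ t.exit → c x = 0 → t.Alternates c x

-- Only finitely many even bit patterns exist at a vertex, so all the local conditions that
-- `matchingPfaffian_toggle` needs can be decided by enumeration.
set_option maxRecDepth 10000 in
theorem Passage.compatible_cornerBits : ∀ t : Passage, ∀ w s e n : ZMod 2, w + s + e + n = 0 →
    t.Compatible (cornerBits w s e n) := by
  have h1 : ∀ t : Passage, ∀ w s e n : ZMod 2, w + s + e + n = 0 →
    t.rotation (cornerBits w s e n) t.exit = t.entry := by decide
  have h2 : ∀ t : Passage, ∀ w s e n : ZMod 2, w + s + e + n = 0 →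
    ∀ x, cornerBits w s e n x = 1 → x ≠ t.entry → x ≠ t.exit →
      t.rotation (cornerBits w s e n) x = x := by decide
  have h3 : ∀ t : Passage, ∀ w s e n : ZMod 2, w + s + e + n = 0 →
    cornerBits w s e n t.entry = 1 → localMate (t.toggle (cornerBits w s e n)) t.entry =
      t.rotation (cornerBits w s e n) t.entry := by decide
  have h4 : ∀ t : Passage, ∀ w s e n : ZMod 2, w + s + e + n = 0 →
    cornerBits w s e n t.entry = 1 →
      t.toggle (cornerBits w s e n) (t.rotation (cornerBits w s e n) t.entry) = 0 ∧
      localMate (t.toggle (cornerBits w s e n)) (t.rotation (cornerBits w s e n) t.entry) =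
        t.entry := by decide
  have h5 : ∀ t : Passage, ∀ w s e n : ZMod 2, w + s + e + n = 0 →
    cornerBits w s e n t.exit = 0 → localMate (cornerBits w s e n) t.exit ≠ t.exit ∧
      t.rotation (cornerBits w s e n) (localMate (cornerBits w s e n) t.exit) = t.exit := by decide
  have h6 : ∀ t : Passage, ∀ w s e n : ZMod 2, w + s + e + n = 0 → ∀ x, x ≠ t.exit →
    cornerBits w s e n x = 0 → t.Alternates (cornerBits w s e n) x := by decide
  exact fun t w s e n h => ⟨h1 t w s e n h, h2 t w s e n h, h3 t w s e n h, h4 t w s e n h,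
    h5 t w s e n h, h6 t w s e n h⟩

theorem Passage.compatible (t : Passage) {c : GadgetVertex → ZMod 2} (hi : c .inner = 0)
    (ho : c .outer = 0) (heven : c .west + c .south + c .east + c .north = 0) :
    t.Compatible c := by
  rw [eq_cornerBits hi ho]
  exact t.compatible_cornerBits _ _ _ _ heven

theorem localMate_spec {c : GadgetVertex → ZMod 2} (hi : c .inner = 0)
    (ho : c .outer = 0) (heven : c .west + c .south + c .east + c .north = 0) (x : GadgetVertex)
    (hx : c x = 0) : c (localMate c x) = 0 ∧ localMate c (localMate c x) = x := by
  have h : ∀ w s e n : ZMod 2, w + s + e + n = 0 → ∀ x, cornerBits w s e n x = 0 →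
      cornerBits w s e n (localMate (cornerBits w s e n) x) = 0 ∧
      localMate (cornerBits w s e n) (localMate (cornerBits w s e n) x) = x := by decide
  rw [eq_cornerBits hi ho] at hx ⊢
  exact h _ _ _ _ heven x hx

theorem classSign_mul_self (o : FisherOrientation) (c : EdgeClass) :
    classSign o c * classSign o c = 1 := by
  unfold classSign
  split_ifs <;> norm_num

/-- The ordered pairs of adjacent vertices of a gadget. -/
def gadgetPairs : List (GadgetVertex × GadgetVertex) :=
  [(.west, .inner), (.inner, .west), (.inner, .south), (.south, .inner), (.south, .west),
    (.west, .south), (.east, .outer), (.outer, .east), (.outer, .north), (.north, .outer),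
    (.north, .east), (.east, .north), (.inner, .outer), (.outer, .inner)]

theorem gadgetSign_mul_self (o : FisherOrientation) {x y : GadgetVertex}
    (h : (x, y) ∈ gadgetPairs) : gadgetSign o x y * gadgetSign o x y = 1 := by
  revert h
  cases x <;> cases y <;> first
    | exact fun h => absurd h (by decide)
    | (intro _; simp [gadgetSign, classSign_mul_self])

theorem localMate_mem_gadgetPairs {c : GadgetVertex → ZMod 2}
    (hi : c .inner = 0) (ho : c .outer = 0)
    (heven : c .west + c .south + c .east + c .north = 0) (x : GadgetVertex) (hx : c x = 0) :
    (x, localMate c x) ∈ gadgetPairs := by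
  have h : ∀ w s e n : ZMod 2, w + s + e + n = 0 → ∀ x, cornerBits w s e n x = 0 →
      (x, localMate (cornerBits w s e n) x) ∈ gadgetPairs := by decide
  rw [eq_cornerBits hi ho] at hx ⊢
  exact h _ _ _ _ heven x hx

/-- The sign collected inside a gadget by the rotation along a passage. -/
noncomputable def Passage.sign (o : FisherOrientation) (t : Passage) (c : GadgetVertex → ZMod 2) :
    ℝ :=
  ((Equiv.Perm.sign (t.rotation c) : ℤ) : ℝ) *
    ∏ x, if x = t.exit ∨ t.rotation c x = x then 1 else gadgetSign o x (t.rotation c x)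

/-- The value of `Passage.sign`, for an orientation for which the triangles are clockwise odd. -/
noncomputable def Passage.signValue (o : FisherOrientation) (t : Passage)
    (c : GadgetVertex → ZMod 2) : ℝ :=
  match t with
  | .eastNorth => classSign o .northEast
  | .southEast => -(classSign o .innerSouth * classSign o .aEdge * classSign o .eastOuter)
  | .westSouth => classSign o .southWest
  | .northWest => classSign o .outerNorth * classSign o .aEdge * classSign o .westInner
  | .westEast => (if c .south = 0 then -1 else 1) *
      (classSign o .westInner * classSign o .aEdge * classSign o .eastOuter)
  | .southNorth => (if c .east = 0 then -1 else 1) *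
      (classSign o .innerSouth * classSign o .aEdge * classSign o .outerNorth)

theorem Passage.rotation_mem_gadgetPairs (t : Passage) {c : GadgetVertex → ZMod 2}
    (hi : c .inner = 0) (ho : c .outer = 0)
    (heven : c .west + c .south + c .east + c .north = 0) (x : GadgetVertex) (hx : x ≠ t.exit)
    (hne : t.rotation c x ≠ x) : (x, t.rotation c x) ∈ gadgetPairs := by
  have h : ∀ t : Passage, ∀ w s e n : ZMod 2, w + s + e + n = 0 → ∀ x, x ≠ t.exit →
      t.rotation (cornerBits w s e n) x ≠ x →
      (x, t.rotation (cornerBits w s e n) x) ∈ gadgetPairs := by decide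
  rw [eq_cornerBits hi ho] at hne ⊢
  exact h t _ _ _ _ heven x hx hne

/-- A detour through the third vertex of a triangle flips the sign of the rotation. Around a
clockwise odd triangle, a clockwise detour also flips the product of edge signs, so it is free,
whereas a counterclockwise one costs `-1`. The turns used here detour only clockwise; going straight
has one counterclockwise detour, through `south` or through `east`, which is why only these bits
enter `signValue`. -/
theorem Passage.sign_eq (o : FisherOrientation)
    (hw : classSign o .westInner * classSign o .innerSouth * classSign o .southWest = 1)
    (he : classSign o .eastOuter * classSign o .outerNorth * classSign o .northEast = 1)
    (t : Passage) {c : GadgetVertex → ZMod 2} (hi : c .inner = 0)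
    (ho : c .outer = 0) (heven : c .west + c .south + c .east + c .north = 0) :
    t.sign o c = t.signValue o c := by
  have sq := classSign_mul_self o
  -- Signs square to 1, so the triangle relation gives its third sign as the product of the other
  -- two.
  have hw2 : classSign o .southWest = classSign o .westInner * classSign o .innerSouth := by
    linear_combination classSign o .westInner * classSign o .innerSouth * hw -
      classSign o .southWest * (classSign o .innerSouth ^ 2 * sq .westInner + sq .innerSouth)
  have he2 : classSign o .northEast = classSign o .eastOuter * classSign o .outerNorth := by
    linear_combination classSign o .eastOuter * classSign o .outerNorth * he -
      classSign o .northEast * (classSign o .outerNorth ^ 2 * sq .eastOuter + sq .outerNorth)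
  have sq1 := sq .westInner
  have sq2 := sq .innerSouth
  have sq3 := sq .eastOuter
  have sq4 := sq .outerNorth
  have prod_univ (f : GadgetVertex → ℝ) : ∏ x, f x =
      f .west * f .south * f .inner * f .east * f .north * f .outer := by
    have : (Finset.univ : Finset GadgetVertex) =
      {.west, .south, .inner, .east, .north, .outer} := rfl
    rw [this]
    simp [mul_assoc]
  rw [eq_cornerBits hi ho]
  revert heven
  generalize c .west = w
  generalize c .south = s
  generalize c .east = e
  generalize c .north = n
  intro heven
  unfold Passage.sign
  rw [prod_univ]
  have two : ∀ a : ZMod 2, a = 0 ∨ a = 1 := by decide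
  cases t <;> rcases two w with rfl | rfl <;> rcases two s with rfl | rfl <;>
    rcases two e with rfl | rfl <;> rcases two n with rfl | rfl <;> first
    | exact absurd heven (by decide)
    | (simp [Passage.rotation, Passage.path, Passage.signValue, Passage.exit, cornerBits,
        Equiv.swap_apply_def, gadgetSign, hw2, he2]
       try grind)

end Gadget

/-! ### The change of the Pfaffian when a closed curve is added to an even set. -/

section Toggle

variable {n : ℕ}

/-- The indicator of a set of grid edges at the corners of one gadget. -/
def edgeBits (S : GridEdge n → ZMod 2) (p : TorusCell n) (x : GadgetVertex) : ZMod 2 :=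
  halfEdge 0 S (p, x)

/-- A set of grid edges is even if every vertex lies on an even number of its edges. -/
def IsEvenSet (S : GridEdge n → ZMod 2) : Prop :=
  ∀ p, edgeBits S p .west + edgeBits S p .south + edgeBits S p .east + edgeBits S p .north = 0

/-- The perfect matching of the Fisher graph that corresponds to an even set of grid edges. -/
def evenMatching (S : GridEdge n → ZMod 2) (u : FisherVertex n) : FisherVertex n :=
  if edgeBits S u.1 u.2 = 1 then externalMate u else (u.1, localMate (edgeBits S u.1) u.2)

theorem ZMod.two_eq_zero_of_ne_one {a : ZMod 2} (h : a ≠ 1) : a = 0 := by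
  revert a
  decide

theorem edgeBits_inner (S : GridEdge n → ZMod 2) (p : TorusCell n) : edgeBits S p .inner = 0 := rfl

theorem edgeBits_outer (S : GridEdge n → ZMod 2) (p : TorusCell n) : edgeBits S p .outer = 0 := rfl

theorem edgeBits_externalMate (S : GridEdge n → ZMod 2) (u : FisherVertex n) :
    edgeBits S (externalMate u).1 (externalMate u).2 = edgeBits S u.1 u.2 :=
  halfEdge_externalMate 0 S u

theorem evenMatching_of_covered {S : GridEdge n → ZMod 2} {u : FisherVertex n}
    (h : edgeBits S u.1 u.2 = 1) : evenMatching S u = externalMate u :=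
  if_pos h

theorem evenMatching_of_free {S : GridEdge n → ZMod 2} {p : TorusCell n} {x : GadgetVertex}
    (h : edgeBits S p x = 0) : evenMatching S (p, x) = (p, localMate (edgeBits S p) x) :=
  if_neg (by rw [h]; decide)

theorem evenMatching_involutive {S : GridEdge n → ZMod 2} (hS : IsEvenSet S) :
    Function.Involutive (evenMatching S) := by
  rintro ⟨p, x⟩
  by_cases h : edgeBits S p x = 1
  · rw [evenMatching_of_covered (u := (p, x)) h, evenMatching_of_covered,
      externalMate_involutive]
    rw [edgeBits_externalMate]
    exact h
  · have h0 := ZMod.two_eq_zero_of_ne_one h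
    obtain ⟨h1, h2⟩ := localMate_spec (edgeBits_inner S p) (edgeBits_outer S p) (hS p) x h0
    rw [evenMatching_of_free h0, evenMatching_of_free h1, h2]

theorem fisherSign_externalMate (o : FisherOrientation) (u : FisherVertex n) :
    fisherSign o u (externalMate u) = externalSign o u.2 := by
  have h : gadgetSign o u.2 (externalMate u).2 = 0 := by
    rcases u with ⟨p, x⟩
    cases x <;> rfl
  rw [fisherSign, h, ite_self, zero_add, if_pos rfl]

theorem fisherSign_inside (o : FisherOrientation) (p : TorusCell n) {x y : GadgetVertex}
    (h : (x, y) ∈ gadgetPairs) : fisherSign o (p, x) (p, y) = gadgetSign o x y := by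
  revert h
  cases x <;> cases y <;> first
    | exact fun h => absurd h (by decide)
    | (intro _; simp [fisherSign, externalMate])

/-- The Pfaffian of the matching that corresponds to a set of grid edges. -/
noncomputable def matchingPfaffian {ι : Type*} [Fintype ι] [DecidableEq ι] [NeZero n]
    (o : FisherOrientation) (r : ι ⊕ ι ≃ FisherVertex n) (S : GridEdge n → ZMod 2) : ℝ :=
  pfaffianSum ((matchingMatrix (fisherSign o) (evenMatching S)).submatrix r r)

/-- How the Pfaffian of a matching changes when a closed curve along the grid is added to the set
of grid edges.  The curve is given by its passages through the vertices, and by the permutation of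
the vertices that moves along it by one step. -/
theorem matchingPfaffian_toggle {ι : Type*} [Fintype ι] [DecidableEq ι] [NeZero n]
    (o : FisherOrientation) (r : ι ⊕ ι ≃ FisherVertex n) {S S' : GridEdge n → ZMod 2}
    (hS : IsEvenSet S) (t : TorusCell n → Option Passage) (next : Equiv.Perm (TorusCell n))
    (hnone : ∀ p, t p = none → next p = p)
    (hnext : ∀ p k, t p = some k → ∃ k', t (next p) = some k' ∧
      externalMate (p, k.exit) = (next p, k'.entry))
    (hbits_none : ∀ p, t p = none → edgeBits S' p = edgeBits S p)
    (hbits_some : ∀ p k, t p = some k → edgeBits S' p = k.toggle (edgeBits S p)) :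
    matchingPfaffian o r S' =
      (((Equiv.Perm.sign next : ℤ) : ℝ) * ∏ p, (t p).elim 1
        (fun k => k.sign o (edgeBits S p) * externalSign o k.exit)) * matchingPfaffian o r S := by
  have compat (p : TorusCell n) (k : Passage) : k.Compatible (edgeBits S p) :=
    k.compatible (edgeBits_inner S p) (edgeBits_outer S p) (hS p)
  have exit_ne_entry : ∀ k : Passage, k.exit ≠ k.entry := by decide
  -- At gadgets off the curve the choice of `inner` is arbitrary: `next` fixes these cells.
  let exitAt : TorusCell n → GadgetVertex := fun p => (t p).elim .inner Passage.exit
  let f : TorusCell n ≃ {u : FisherVertex n // u.2 = exitAt u.1} :=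
    { toFun := fun p => ⟨(p, exitAt p), rfl⟩
      invFun := fun u => u.1.1
      left_inv := fun p => rfl
      right_inv := fun u => Subtype.ext (Prod.ext rfl u.2.symm) }
  -- `G` carries each exit to the exit of the next gadget; then `L` rotates every local path, taking
  -- that exit to the entry. The product `π` joins the local paths into long cycles that leave each
  -- gadget along a grid edge.
  let G : Equiv.Perm (FisherVertex n) := next.extendDomain f
  let rot : TorusCell n → Equiv.Perm GadgetVertex :=
    fun p => (t p).elim 1 (fun k => k.rotation (edgeBits S p))
  let L : Equiv.Perm (FisherVertex n) := Equiv.prodCongrRight rot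
  let π : Equiv.Perm (FisherVertex n) := L * G
  have hL (p x) : L (p, x) = (p, rot p x) := rfl
  have hG_exit (p) : G (p, exitAt p) = (next p, exitAt (next p)) :=
    Equiv.Perm.extendDomain_apply_image next f p
  have hG (p x) (h : x ≠ exitAt p) : G (p, x) = (p, x) :=
    Equiv.Perm.extendDomain_apply_not_subtype next f h
  have π_none (p x) (hp : t p = none) : π (p, x) = (p, x) := by
    have hrot : rot p = 1 := by simp [rot, hp]
    by_cases h : x = exitAt p
    · subst h
      rw [Equiv.Perm.mul_apply, hG_exit, hnone p hp, hL, hrot]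
      rfl
    · rw [Equiv.Perm.mul_apply, hG p x h, hL, hrot]
      rfl
  have π_exit (p k) (hp : t p = some k) : π (p, k.exit) = externalMate (p, k.exit) := by
    obtain ⟨k', hk', hmate⟩ := hnext p k hp
    have h1 : k.exit = exitAt p := by simp [exitAt, hp]
    have h2 : exitAt (next p) = k'.exit := by simp [exitAt, hk']
    have h3 : rot (next p) = k'.rotation (edgeBits S (next p)) := by simp [rot, hk']
    rw [hmate, h1, Equiv.Perm.mul_apply, hG_exit, hL, h2, h3, (compat _ k').exit_to_entry]
  have π_some (p k x) (hp : t p = some k) (hx : x ≠ k.exit) :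
      π (p, x) = (p, k.rotation (edgeBits S p) x) := by
    have h1 : x ≠ exitAt p := by simpa [exitAt, hp] using hx
    have h3 : rot p = k.rotation (edgeBits S p) := by simp [rot, hp]
    rw [Equiv.Perm.mul_apply, hG p x h1, hL, h3]
  have entry_mate (p k) (hp : t p = some k) : ∃ q k', t q = some k' ∧
      externalMate (p, k.entry) = (q, k'.exit) := by
    obtain ⟨q, rfl⟩ := next.surjective p
    rcases hq : t q with _ | k'
    · rw [hnone q hq, hq] at hp
      cases hp
    · obtain ⟨k'', hk'', hmate⟩ := hnext q k' hq
      have : k'' = k := by rw [hk''] at hp; exact Option.some.inj hp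
      subst this
      exact ⟨q, k', hq, by rw [← hmate, externalMate_involutive]⟩
  -- The vertices at the ends of the edges of the curve.
  let onCurve : FisherVertex n → Prop :=
    fun u => ∃ k, t u.1 = some k ∧ (u.2 = k.entry ∨ u.2 = k.exit)
  have onCurve_mate (u) (hu : onCurve u) : onCurve (externalMate u) := by
    obtain ⟨p, x⟩ := u
    obtain ⟨k, hk, rfl | rfl⟩ := hu
    · obtain ⟨q, k', hq, hmate⟩ := entry_mate p k hk
      rw [hmate]
      exact ⟨k', hq, Or.inr rfl⟩
    · obtain ⟨k', hk', hmate⟩ := hnext p k hk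
      rw [hmate]
      exact ⟨k', hk', Or.inl rfl⟩
  have bits_off (u : FisherVertex n) (hu : ¬ onCurve u) :
      edgeBits S' u.1 u.2 = edgeBits S u.1 u.2 := by
    rcases hp : t u.1 with _ | k
    · rw [hbits_none _ hp]
    · rw [hbits_some _ k hp, Passage.toggle, if_neg]
      exact fun h => hu ⟨k, hp, h⟩
  have bits_on (p k) (hp : t p = some k) (x) (hx : x = k.entry ∨ x = k.exit) :
      edgeBits S' p x = edgeBits S p x + 1 := by
    rw [hbits_some _ k hp, Passage.toggle, if_pos hx]
  have π_covered (u : FisherVertex n) (hu : ¬ onCurve u) (h : edgeBits S u.1 u.2 = 1) :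
      π u = u := by
    obtain ⟨p, x⟩ := u
    rcases hp : t p with _ | k
    · exact π_none p x hp
    · have h1 : x ≠ k.entry := fun h => hu ⟨k, hp, Or.inl h⟩
      have h2 : x ≠ k.exit := fun h => hu ⟨k, hp, Or.inr h⟩
      rw [π_some p k x hp h2, (compat p k).fixed x h h1 h2]
  have one_add_one : (1 : ZMod 2) + 1 = 0 := by decide
  -- The hypotheses of `pfaffianSum_matchingMatrix_rotate`. The cases are: covered vertices off the
  -- curve and unvisited gadgets, which are fixed; exits; covered entries; and free vertices, for
  -- which `Passage.Alternates` is designed.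
  have key (u : FisherVertex n) : evenMatching S' (π u) = π (evenMatching S u) ∧
      (π u = evenMatching S u ∨ π (evenMatching S u) = u ∨
        (π u = u ∧ π (evenMatching S u) = evenMatching S u)) := by
    by_cases hcov : edgeBits S u.1 u.2 = 1 ∧ ¬ onCurve u
    · obtain ⟨h1, h2⟩ := hcov
      have h3 : ¬ onCurve (externalMate u) := fun h => h2 (by
        simpa [externalMate_involutive u] using onCurve_mate _ h)
      have h4 : edgeBits S (externalMate u).1 (externalMate u).2 = 1 := by
        rw [edgeBits_externalMate, h1]
      rw [evenMatching_of_covered h1, π_covered u h2 h1, π_covered _ h3 h4,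
        evenMatching_of_covered (by rw [bits_off u h2, h1])]
      exact ⟨rfl, Or.inr (Or.inr ⟨rfl, rfl⟩)⟩
    obtain ⟨p, x⟩ := u
    rcases hp : t p with _ | k
    · have hoff : ¬ onCurve (p, x) := by
        rintro ⟨k, hk, -⟩
        rw [hp] at hk
        cases hk
      have h0 : edgeBits S p x = 0 :=
        ZMod.two_eq_zero_of_ne_one fun h => hcov ⟨h, hoff⟩
      have h0' : edgeBits S' p x = 0 := by rw [bits_off (p, x) hoff, h0]
      rw [evenMatching_of_free h0, π_none p _ hp, π_none p _ hp, evenMatching_of_free h0',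
        hbits_none p hp]
      exact ⟨rfl, Or.inr (Or.inr ⟨rfl, rfl⟩)⟩
    have hc := compat p k
    have hb := hbits_some p k hp
    by_cases hx : x = k.exit
    · subst hx
      obtain ⟨k', hk', hmate⟩ := hnext p k hp
      rw [π_exit p k hp]
      by_cases h1 : edgeBits S p k.exit = 1
      · rw [evenMatching_of_covered (u := (p, k.exit)) h1]
        refine ⟨?_, Or.inl rfl⟩
        have h2 : edgeBits S (next p) k'.entry = 1 := by
          have := edgeBits_externalMate S (p, k.exit)
          rw [hmate] at this
          exact this.trans h1
        have h3 : edgeBits S' (next p) k'.entry = 0 := by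
          rw [bits_on _ k' hk' _ (Or.inl rfl), h2, one_add_one]
        rw [hmate, evenMatching_of_free h3, π_some _ k' _ hk' (exit_ne_entry k').symm,
          hbits_some _ k' hk', (compat _ k').entry_covered h2]
      · have h0 := ZMod.two_eq_zero_of_ne_one h1
        obtain ⟨h2, h3⟩ := hc.exit_free h0
        have h4 : π (evenMatching S (p, k.exit)) = (p, k.exit) := by
          rw [evenMatching_of_free h0, π_some p k _ hp h2, h3]
        refine ⟨?_, Or.inr (Or.inl h4)⟩
        rw [h4, evenMatching_of_covered, externalMate_involutive]
        rw [edgeBits_externalMate, bits_on p k hp _ (Or.inr rfl), h0, zero_add]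
    rw [π_some p k x hp hx]
    by_cases h1 : edgeBits S p x = 1
    · have hxe : x = k.entry := by
        by_contra hne
        refine hcov ⟨h1, ?_⟩
        rintro ⟨k', hk', h⟩
        have : k' = k := Option.some.inj (hk'.symm.trans hp)
        subst this
        exact h.elim hne hx
      subst hxe
      obtain ⟨q, k', hq, hmate⟩ := entry_mate p k hp
      have h4 : π (evenMatching S (p, k.entry)) = (p, k.entry) := by
        rw [evenMatching_of_covered h1, hmate, π_exit q k' hq, ← hmate, externalMate_involutive]
      refine ⟨?_, Or.inr (Or.inl h4)⟩
      obtain ⟨h5, h6⟩ := hc.entry_covered' h1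
      rw [h4, evenMatching_of_free (by rw [hb, h5]), hb, h6]
    · have h0 := ZMod.two_eq_zero_of_ne_one h1
      rw [evenMatching_of_free h0]
      rcases hc.alternates x hx h0 with ⟨h2, h3, h4⟩ | ⟨h2, h3, h4, h5⟩ | ⟨h2, h3, h4, h5, h6⟩
      · refine ⟨?_, Or.inl (by rw [h2])⟩
        rw [h2]
        by_cases h7 : localMate (edgeBits S p) x = k.exit
        · rw [h7, π_exit p k hp, evenMatching_of_covered]
          change edgeBits S' p k.exit = 1
          rw [bits_on p k hp _ (Or.inr rfl), h3 h7, zero_add]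
        · obtain ⟨h8, h9⟩ := h4 h7
          rw [π_some p k _ hp h7, evenMatching_of_free (by rw [hb, h8]), hb, h9]
      · rw [π_some p k _ hp h2, h3]
        exact ⟨by rw [evenMatching_of_free (by rw [hb, h4]), hb, h5], Or.inr (Or.inl rfl)⟩
      · rw [π_some p k _ hp h3, h4, h2]
        exact ⟨by rw [evenMatching_of_free (by rw [hb, h5]), hb, h6],
          Or.inr (Or.inr ⟨rfl, rfl⟩)⟩
  have step_exit (p k) (hp : t p = some k) :
      π (p, k.exit) ≠ (p, k.exit) ∧
        fisherSign o (p, k.exit) (π (p, k.exit)) = externalSign o k.exit := by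
    rw [π_exit p k hp, fisherSign_externalMate]
    refine ⟨?_, rfl⟩
    cases k <;> simp [externalMate, Passage.exit]
  have step_inside (p k x) (hp : t p = some k) (hx : x ≠ k.exit)
      (hne : k.rotation (edgeBits S p) x ≠ x) :
      (x, k.rotation (edgeBits S p) x) ∈ gadgetPairs :=
    k.rotation_mem_gadgetPairs (edgeBits_inner S p) (edgeBits_outer S p) (hS p) x hx hne
  have unit (u : FisherVertex n) (hu : π u ≠ u) :
      fisherSign o u (π u) * fisherSign o u (π u) = 1 := by
    obtain ⟨p, x⟩ := u
    rcases hp : t p with _ | k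
    · exact absurd (π_none p x hp) hu
    by_cases hx : x = k.exit
    · subst hx
      rw [(step_exit p k hp).2]
      cases k <;> simp [externalSign, Passage.exit, classSign_mul_self]
    · rw [π_some p k x hp hx] at hu ⊢
      have hmem := step_inside p k x hp hx fun h => hu (by rw [h])
      rw [fisherSign_inside o p hmem, gadgetSign_mul_self o hmem]
  have cell (p : TorusCell n) : ((Equiv.Perm.sign (rot p) : ℤ) : ℝ) *
      ∏ x, stepSign (fisherSign o) π (p, x) = (t p).elim 1
        (fun k => k.sign o (edgeBits S p) * externalSign o k.exit) := by
    rcases hp : t p with _ | k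
    · have hrot : rot p = 1 := by simp [rot, hp]
      simp [hrot, stepSign, π_none p _ hp]
    · have hrot : rot p = k.rotation (edgeBits S p) := by simp [rot, hp]
      have hstep (x : GadgetVertex) : stepSign (fisherSign o) π (p, x) =
          (if x = k.exit ∨ k.rotation (edgeBits S p) x = x then 1
            else gadgetSign o x (k.rotation (edgeBits S p) x)) *
          (if x = k.exit then externalSign o k.exit else 1) := by
        unfold stepSign
        by_cases hx : x = k.exit
        · subst hx
          rw [if_neg (step_exit p k hp).1, (step_exit p k hp).2]
          simp
        · rw [π_some p k x hp hx]
          by_cases hne : k.rotation (edgeBits S p) x = x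
          · simp [hx, hne]
          · simp [hx, hne, fisherSign_inside o p (step_inside p k x hp hx hne)]
      simp only [hstep, Finset.prod_mul_distrib, Finset.prod_ite_eq', Finset.mem_univ, if_true,
        hrot, Option.elim_some, Passage.sign]
      ring
  have hsign : ((Equiv.Perm.sign π : ℤ) : ℝ) =
      (∏ p, ((Equiv.Perm.sign (rot p) : ℤ) : ℝ)) * ((Equiv.Perm.sign next : ℤ) : ℝ) := by
    rw [Equiv.Perm.sign_mul, Equiv.Perm.sign_prodCongrRight, Equiv.Perm.sign_extendDomain]
    push_cast
    rfl
  rw [matchingPfaffian, matchingPfaffian, pfaffianSum_matchingMatrix_rotate r (fisherSign_skew o) π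
    (fun u => (key u).1) (fun u => (key u).2) unit]
  congr 1
  have hprod : ∏ u, stepSign (fisherSign o) π u = ∏ p, ∏ x, stepSign (fisherSign o) π (p, x) :=
    Fintype.prod_prod_type _
  rw [hsign, hprod]
  simp only [← cell, Finset.prod_mul_distrib]
  ring

end Toggle

/-! ### Even sets modulo face boundaries: the first homology of the torus mod 2. -/

section Homology

variable {n : ℕ}

theorem edgeBits_add (S T : GridEdge n → ZMod 2) (p : TorusCell n) (x : GadgetVertex) :
    edgeBits (S + T) p x = edgeBits S p x + edgeBits T p x := by
  cases x <;> simp [edgeBits, halfEdge]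

/-- The group of even sets of grid edges, under symmetric difference. -/
def evenSets (n : ℕ) : AddSubgroup (GridEdge n → ZMod 2) where
  carrier := {S | IsEvenSet S}
  zero_mem' p := by simp [edgeBits, halfEdge]
  add_mem' {S T} hS hT p := by
    simp only [edgeBits_add]
    linear_combination hS p + hT p
  neg_mem' {S} hS := by
    rwa [show -S = S from funext fun e => CharTwo.neg_eq (S e)]

/-- The boundary of the face of the square grid with lower left corner `p`. -/
def faceSet (p : TorusCell n) : GridEdge n → ZMod 2
  | (q, .right) => if q.1 = p.1 ∧ (q.2 = p.2 ∨ q.2 = p.2 + 1) then 1 else 0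
  | (q, .up) => if q.2 = p.2 ∧ (q.1 = p.1 ∨ q.1 = p.1 + 1) then 1 else 0

/-- A horizontal cycle. -/
def rowSet (n : ℕ) : GridEdge n → ZMod 2
  | (q, .right) => if q.2 = 0 then 1 else 0
  | (_, .up) => 0

/-- A vertical cycle. -/
def columnSet (n : ℕ) : GridEdge n → ZMod 2
  | (_, .right) => 0
  | (q, .up) => if q.1 = 0 then 1 else 0

/-- The sums of boundaries of faces. -/
def faceSpan (n : ℕ) : AddSubgroup (GridEdge n → ZMod 2) :=
  AddSubgroup.closure (Set.range faceSet)

/-- The primitive is given by partial sums from 0; a vanishing total makes it consistent across the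
wrap-around from `n - 1` to 0. -/
theorem ZMod.exists_sub_shift_eq [NeZero n] {A : Type*} [AddCommGroup A] (g : ZMod n → A)
    (hg : ∑ i, g i = 0) : ∃ G : ZMod n → A, ∀ i, G i - G (i - 1) = g i := by
  have htotal : ∑ k ∈ Finset.range n, g (k : ZMod n) = 0 := by
    rw [← hg]
    symm
    refine Finset.sum_bij (fun i _ => i.val) (fun i _ => Finset.mem_range.2 (ZMod.val_lt i))
      (fun i _ j _ h => ZMod.val_injective n h) (fun k hk => ⟨k, Finset.mem_univ _, ?_⟩)
      (fun i _ => by rw [ZMod.natCast_zmod_val])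
    exact ZMod.val_cast_of_lt (Finset.mem_range.1 hk)
  refine ⟨fun i => ∑ k ∈ Finset.range (i.val + 1), g k, fun i => ?_⟩
  simp only
  rw [Finset.sum_range_succ, ZMod.natCast_zmod_val, add_sub_right_comm]
  suffices h : ∑ k ∈ Finset.range ((i - 1).val + 1), g (k : ZMod n) =
      ∑ k ∈ Finset.range i.val, g (k : ZMod n) by
    rw [h, sub_self, zero_add]
  by_cases hi : i = 0
  · subst hi
    rw [ZMod.val_zero, Finset.sum_range_zero, ← htotal]
    congr 2
    obtain ⟨m, rfl⟩ := Nat.exists_eq_succ_of_ne_zero (NeZero.ne n)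
    rw [zero_sub, ZMod.val_neg_one]
  · congr 2
    have h1 : i.val ≠ 0 := by rwa [Ne, ZMod.val_eq_zero]
    have hn : 1 < n := lt_of_le_of_lt (Nat.one_le_iff_ne_zero.2 h1) (ZMod.val_lt i)
    have : Fact (1 < n) := ⟨hn⟩
    rw [ZMod.val_sub (by rw [ZMod.val_one]; omega), ZMod.val_one]
    omega

theorem one_ne_zero_of_even [NeZero n] (hn : Even n) : (1 : ZMod n) ≠ 0 := by
  have : Fact (1 < n) := ⟨by
    have := NeZero.ne n
    obtain ⟨k, rfl⟩ := hn
    omega⟩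
  exact one_ne_zero

/-- An even set that meets a vertical and a horizontal closed dual path evenly is a sum of
boundaries of faces. -/
theorem mem_faceSpan_of_sum_eq_zero [NeZero n] (hn : (1 : ZMod n) ≠ 0) {S : GridEdge n → ZMod 2}
    (hS : IsEvenSet S) (hup : ∑ i, S ((i, 0), .up) = 0) (hright : ∑ j, S ((0, j), .right) = 0) :
    S ∈ faceSpan n := by
  have heven (i j : ZMod n) : S ((i, j), .right) - S ((i - 1, j), .right) =
      S ((i, j - 1), .up) - S ((i, j), .up) := by
    have h := hS (i, j)
    simp only [edgeBits, halfEdge] at h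
    have two (a : ZMod 2) : a + a = 0 := CharTwo.add_self_eq_zero a
    linear_combination h - two (S ((i - 1, j), .right)) - two (S ((i, j - 1), .up))
  -- The number of upward edges does not depend on the row.
  have hrow (j : ZMod n) : ∑ i, S ((i, j), .up) = ∑ i, S ((i, j - 1), .up) := by
    have h := Finset.sum_congr (rfl : (Finset.univ : Finset (ZMod n)) = _) fun i _ => heven i j
    rw [Finset.sum_sub_distrib, Finset.sum_sub_distrib] at h
    have hshift : ∑ i, S ((i - 1, j), .right) = ∑ i, S ((i, j), .right) :=
      (Equiv.subRight (1 : ZMod n)).sum_comp fun i => S ((i, j), GridDir.right)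
    rw [hshift, sub_self] at h
    exact (sub_eq_zero.1 h.symm).symm
  have hrows (j : ZMod n) : ∑ i, S ((i, j), .up) = 0 := by
    obtain ⟨k, rfl⟩ := ZMod.natCast_zmod_surjective j
    induction k with
    | zero => simpa using hup
    | succ k ih => rw [hrow, Nat.cast_succ, add_sub_cancel_right, ih]
  choose G hG using fun j => ZMod.exists_sub_shift_eq (fun i => S ((i, j), .up)) (hrows j)
  -- The defect of the right edges with respect to `G` does not depend on the column.
  let d : ZMod n → ZMod n → ZMod 2 := fun i j => S ((i, j), .right) - (G j i - G (j - 1) i)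
  have hd (i j : ZMod n) : d i j = d (i - 1) j := by
    have h1 := hG j i
    have h2 := hG (j - 1) i
    have h3 := heven i j
    have two (a : ZMod 2) : a + a = 0 := CharTwo.add_self_eq_zero a
    simp only [d]
    linear_combination h3 - h1 + h2 - two (S ((i, j), .up)) + two (S ((i, j - 1), .up))
  have hd0 (i j : ZMod n) : d i j = d 0 j := by
    obtain ⟨k, rfl⟩ := ZMod.natCast_zmod_surjective i
    induction k with
    | zero => simp
    | succ k ih => rw [hd, Nat.cast_succ, add_sub_cancel_right, ih]
  obtain ⟨ρ, hρ⟩ := ZMod.exists_sub_shift_eq (fun j => d 0 j) (by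
    have hshift : ∑ j, G (j - 1) 0 = ∑ j, G j 0 :=
      (Equiv.subRight (1 : ZMod n)).sum_comp fun j => G j 0
    simp only [d, Finset.sum_sub_distrib]
    rw [hshift, hright, sub_self, sub_self])
  -- A potential on the faces, whose differences across the edges are `S`. The term `ρ` absorbs the
  -- defect of the right edges without changing the differences across upward edges.
  let U : TorusCell n → ZMod 2 := fun p => G p.2 p.1 + ρ p.2
  have hU_up (i j : ZMod n) : U (i, j) - U (i - 1, j) = S ((i, j), .up) := by
    simp only [U]
    linear_combination hG j i
  have hU_right (i j : ZMod n) : U (i, j) - U (i, j - 1) = S ((i, j), .right) := by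
    have h := hd0 i j
    have h' := hρ j
    simp only [U, d] at h h' ⊢
    linear_combination h' - h
  -- The two faces on either side of an edge are distinct.
  have hne (a : ZMod n) : a - 1 ≠ a := fun h => hn (sub_eq_self.1 h)
  have hsum : S = ∑ p, U p • faceSet p := by
    funext e
    rcases e with ⟨⟨i, j⟩, _ | _⟩
    · rw [Finset.sum_apply, ← hU_right, CharTwo.sub_eq_add]
      have hsub : ({(i, j), (i, j - 1)} : Finset (TorusCell n)) ⊆ Finset.univ :=
        Finset.subset_univ _
      rw [← Finset.sum_subset hsub, Finset.sum_pair]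
      · simp [faceSet]
      · simp [(hne j).symm]
      · rintro ⟨a, b⟩ - hp
        have : ¬ (i = a ∧ (j = b ∨ j = b + 1)) := by
          rintro ⟨rfl, rfl | rfl⟩ <;> simp at hp
        simp [faceSet, this]
    · rw [Finset.sum_apply, ← hU_up, CharTwo.sub_eq_add]
      have hsub : ({(i, j), (i - 1, j)} : Finset (TorusCell n)) ⊆ Finset.univ :=
        Finset.subset_univ _
      rw [← Finset.sum_subset hsub, Finset.sum_pair]
      · simp [faceSet]
      · simp [(hne i).symm]
      · rintro ⟨a, b⟩ - hp
        have : ¬ (j = b ∧ (i = a ∨ i = a + 1)) := by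
          rintro ⟨rfl, rfl | rfl⟩ <;> simp at hp
        simp [faceSet, this]
  rw [hsum]
  refine AddSubgroup.sum_mem _ fun p _ => ?_
  rcases (by decide : ∀ a : ZMod 2, a = 0 ∨ a = 1) (U p) with h | h
  · rw [h, zero_smul]
    exact AddSubgroup.zero_mem _
  · rw [h, one_smul]
    exact AddSubgroup.subset_closure ⟨p, rfl⟩

theorem isEvenSet_rowSet : IsEvenSet (rowSet n) := by
  intro p
  simp only [edgeBits, halfEdge, rowSet]
  split_ifs <;> decide

theorem isEvenSet_columnSet : IsEvenSet (columnSet n) := by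
  intro p
  simp only [edgeBits, halfEdge, columnSet]
  split_ifs <;> decide

/-- The row and the column realise all four pairs of intersection parities, so subtracting a
suitable representative makes both parities zero. -/
theorem exists_faceSpan_add [NeZero n] (hn : (1 : ZMod n) ≠ 0) {S : GridEdge n → ZMod 2}
    (hS : IsEvenSet S) : ∃ F ∈ faceSpan n,
      S = 0 + F ∨ S = rowSet n + F ∨ S = columnSet n + F ∨ S = columnSet n + rowSet n + F := by
  have two : ∀ a : ZMod 2, a = 0 ∨ a = 1 := by decide
  have row_up : ∑ i, rowSet n ((i, 0), .up) = 0 := by simp [rowSet]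
  have row_right : ∑ j, rowSet n ((0, j), .right) = 1 := by simp [rowSet]
  have column_up : ∑ i, columnSet n ((i, 0), .up) = 1 := by simp [columnSet]
  have column_right : ∑ j, columnSet n ((0, j), .right) = 0 := by simp [columnSet]
  have reduce (T : GridEdge n → ZMod 2) (hT : IsEvenSet T)
      (hup : ∑ i, S ((i, 0), .up) = ∑ i, T ((i, 0), .up))
      (hright : ∑ j, S ((0, j), .right) = ∑ j, T ((0, j), .right)) : S - T ∈ faceSpan n :=
    mem_faceSpan_of_sum_eq_zero hn (AddSubgroup.sub_mem (evenSets n) hS hT)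
      (by simp [hup]) (by simp [hright])
  rcases two (∑ i, S ((i, 0), .up)) with hu | hu <;>
    rcases two (∑ j, S ((0, j), .right)) with hr | hr
  · exact ⟨S - 0, reduce 0 (AddSubgroup.zero_mem (evenSets n)) (by simp [hu]) (by simp [hr]),
      Or.inl (by abel)⟩
  · exact ⟨S - rowSet n, reduce _ isEvenSet_rowSet (by rw [hu, row_up]) (by rw [hr, row_right]),
      Or.inr (Or.inl (by abel))⟩
  · exact ⟨S - columnSet n, reduce _ isEvenSet_columnSet (by rw [hu, column_up])
      (by rw [hr, column_right]), Or.inr (Or.inr (Or.inl (by abel)))⟩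
  · refine ⟨S - (columnSet n + rowSet n), reduce _
      (AddSubgroup.add_mem (evenSets n) isEvenSet_columnSet isEvenSet_rowSet) ?_ ?_,
      Or.inr (Or.inr (Or.inr (by abel)))⟩
    · simp only [Pi.add_apply, Finset.sum_add_distrib, row_up, column_up, hu, add_zero]
    · simp only [Pi.add_apply, Finset.sum_add_distrib, row_right, column_right, hr, zero_add]

end Homology

/-! ### Sign factors of the boundary of a face, a row and a column. -/

section Toggles

variable {n : ℕ}

theorem classSign_triangles {o : FisherOrientation} (ho : o.ClockwiseOdd) :
    classSign o .westInner * classSign o .innerSouth * classSign o .southWest = 1 ∧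
      classSign o .eastOuter * classSign o .outerNorth * classSign o .northEast = 1 := by
  have h1 := ho _ (List.mem_cons_self)
  have h2 := ho _ (List.mem_cons_of_mem _ List.mem_cons_self)
  simp only [List.countP_cons, List.countP_nil] at h1 h2
  unfold classSign
  constructor
  · revert h1
    cases o .westInner <;> cases o .innerSouth <;> cases o .southWest <;> simp
  · revert h2
    cases o .eastOuter <;> cases o .outerNorth <;> cases o .northEast <;> simp

theorem exists_perm_four_cycle {α : Type*} [Fintype α] [DecidableEq α] {a b c d : α} (hab : a ≠ b)
    (hac : a ≠ c) (had : a ≠ d) (hbc : b ≠ c) (hbd : b ≠ d) (hcd : c ≠ d) :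
    ∃ σ : Equiv.Perm α, Equiv.Perm.sign σ = -1 ∧ σ a = b ∧ σ b = c ∧ σ c = d ∧ σ d = a ∧
      ∀ x, x ≠ a → x ≠ b → x ≠ c → x ≠ d → σ x = x := by
  refine ⟨Equiv.swap a b * (Equiv.swap b c * Equiv.swap c d), ?_, ?_, ?_, ?_, ?_, ?_⟩
  · simp [Equiv.Perm.sign_swap hab, Equiv.Perm.sign_swap hbc, Equiv.Perm.sign_swap hcd]
  · simp [Equiv.swap_apply_def, hab, hac, had]
  · simp [Equiv.swap_apply_def, hbc, hbd, hac.symm, hbc.symm]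
  · simp [Equiv.swap_apply_def, hbd.symm, hcd.symm, had.symm]
  · simp
  · intro x hxa hxb hxc hxd
    simp [Equiv.swap_apply_def, hxa, hxb, hxc, hxd]

/-- The boundary is run clockwise, and its four turns have signs independent of `S`. Their product,
with the signs of the external edges, is `-1` and cancels the sign of the 4-cycle of cells. -/
theorem matchingPfaffian_add_faceSet {ι : Type*} [Fintype ι] [DecidableEq ι] [NeZero n]
    (hn : (1 : ZMod n) ≠ 0) {o : FisherOrientation} (ho : o.ClockwiseOdd)
    (r : ι ⊕ ι ≃ FisherVertex n) {S : GridEdge n → ZMod 2} (hS : IsEvenSet S) (p : TorusCell n) :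
    matchingPfaffian o r (S + faceSet p) = matchingPfaffian o r S := by
  obtain ⟨i, j⟩ := p
  have hadd (a : ZMod n) : a + 1 ≠ a := fun h => hn (by simpa using h)
  have hsub (a : ZMod n) : a - 1 ≠ a := fun h => hn (sub_eq_self.1 h)
  have h12 : (i, j) ≠ (i, j + 1) := by simp [hn]
  have h13 : (i, j) ≠ (i + 1, j + 1) := by simp [hn]
  have h14 : (i, j) ≠ (i + 1, j) := by simp [hn]
  have h23 : (i, j + 1) ≠ (i + 1, j + 1) := by simp [hn]
  have h24 : (i, j + 1) ≠ (i + 1, j) := by simp [hn]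
  have h34 : (i + 1, j + 1) ≠ (i + 1, j) := by simp [hn]
  obtain ⟨next, hsign, n1, n2, n3, n4, nfix⟩ := exists_perm_four_cycle h12 h13 h14 h23 h24 h34
  let t : TorusCell n → Option Passage := fun q =>
    if q = (i, j) then some .eastNorth else if q = (i, j + 1) then some .southEast else
      if q = (i + 1, j + 1) then some .westSouth else
        if q = (i + 1, j) then some .northWest else none
  have t1 : t (i, j) = some .eastNorth := if_pos rfl
  have t2 : t (i, j + 1) = some .southEast := by simp [t, hn]
  have t3 : t (i + 1, j + 1) = some .westSouth := by simp [t, hn]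
  have t4 : t (i + 1, j) = some .northWest := by simp [t, hn]
  have tnone (q) (h : t q = none) :
      q ≠ (i, j) ∧ q ≠ (i, j + 1) ∧ q ≠ (i + 1, j + 1) ∧ q ≠ (i + 1, j) := by
    refine ⟨?_, ?_, ?_, ?_⟩ <;> rintro rfl <;> simp [t1, t2, t3, t4] at h
  have tsome (q k) (h : t q = some k) : (q = (i, j) ∧ k = .eastNorth) ∨
      (q = (i, j + 1) ∧ k = .southEast) ∨ (q = (i + 1, j + 1) ∧ k = .westSouth) ∨
      (q = (i + 1, j) ∧ k = .northWest) := by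
    simp only [t] at h
    split_ifs at h <;> simp_all
  rw [matchingPfaffian_toggle o r hS t next]
  · obtain ⟨hw, he⟩ := classSign_triangles ho
    have hcell (q : TorusCell n) (k : Passage) : k.sign o (edgeBits S q) = k.signValue o (edgeBits S q) :=
      k.sign_eq o hw he (edgeBits_inner S q) (edgeBits_outer S q) (hS q)
    have hprod : ∏ q, (t q).elim 1 (fun k => k.sign o (edgeBits S q) * externalSign o k.exit) =
        -1 := by
      rw [← Finset.prod_subset
        (Finset.subset_univ {(i, j), (i, j + 1), (i + 1, j + 1), (i + 1, j)})]
      · rw [Finset.prod_insert (by simp [hn]), Finset.prod_insert (by simp [hn]),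
          Finset.prod_insert (by simp [hn]), Finset.prod_singleton, t1, t2, t3, t4]
        simp only [Option.elim_some, hcell, Passage.signValue, externalSign, Passage.exit]
        have sqh := classSign_mul_self o .horizontal
        have sqv := classSign_mul_self o .vertical
        have sqa := classSign_mul_self o .aEdge
        generalize classSign o .horizontal = sh at *
        generalize classSign o .vertical = sv at *
        generalize classSign o .aEdge = sa at *
        calc _ = -((classSign o .westInner * classSign o .innerSouth * classSign o .southWest) *
              (classSign o .eastOuter * classSign o .outerNorth * classSign o .northEast)) *
              ((sh * sh) * (sv * sv) * (sa * sa)) := by ring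
          _ = -1 := by rw [hw, he, sqh, sqv, sqa]; norm_num
      · intro q _ hq
        rcases h : t q with _ | k
        · rfl
        · simp only [Finset.mem_insert, Finset.mem_singleton, not_or] at hq
          rcases tsome q k h with ⟨h', -⟩ | ⟨h', -⟩ | ⟨h', -⟩ | ⟨h', -⟩
          exacts [absurd h' hq.1, absurd h' hq.2.1, absurd h' hq.2.2.1, absurd h' hq.2.2.2]
    rw [hprod, hsign]
    norm_num
  · intro q hq
    obtain ⟨h1, h2, h3, h4⟩ := tnone q hq
    exact nfix q h1 h2 h3 h4
  · intro q k h
    rcases tsome q k h with ⟨rfl, rfl⟩ | ⟨rfl, rfl⟩ | ⟨rfl, rfl⟩ | ⟨rfl, rfl⟩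
    · exact ⟨.southEast, by rw [n1, t2], by rw [n1]; rfl⟩
    · exact ⟨.westSouth, by rw [n2, t3], by rw [n2]; rfl⟩
    · exact ⟨.northWest, by rw [n3, t4], by rw [n3]; simp [externalMate, Passage.exit,
        Passage.entry]⟩
    · exact ⟨.eastNorth, by rw [n4, t1], by rw [n4]; simp [externalMate, Passage.exit,
        Passage.entry]⟩
  · intro q hq
    obtain ⟨h1, h2, h3, h4⟩ := tnone q hq
    obtain ⟨a, b⟩ := q
    funext x
    rw [edgeBits_add, add_eq_left]
    cases x <;> simp only [edgeBits, halfEdge, faceSet, ite_eq_right_iff, one_ne_zero, imp_false,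
      sub_eq_iff_eq_add] <;> rintro ⟨rfl, rfl | rfl⟩ <;> simp at h1 h2 h3 h4
  · intro q k h
    rcases tsome q k h with ⟨rfl, rfl⟩ | ⟨rfl, rfl⟩ | ⟨rfl, rfl⟩ | ⟨rfl, rfl⟩ <;> funext x <;>
      rw [edgeBits_add] <;> cases x <;>
      simp [edgeBits, halfEdge, faceSet, Passage.toggle, Passage.entry, Passage.exit, hn, hadd,
        hsub]

theorem sign_addRight_one [NeZero n] (hn : Even n) :
    Equiv.Perm.sign (Equiv.addRight (1 : ZMod n)) = -1 := by
  obtain ⟨m, rfl⟩ := Nat.exists_eq_succ_of_ne_zero (NeZero.ne n)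
  have h : (Equiv.addRight (1 : ZMod (m + 1)) : Equiv.Perm (Fin (m + 1))) = finRotate (m + 1) := by
    ext i
    rw [finRotate_apply]
    rfl
  have hm : Odd m := by
    rcases Nat.even_or_odd m with h | h
    · exact absurd hn (by simpa [Nat.even_add_one] using h)
    · exact h
  calc Equiv.Perm.sign (Equiv.addRight (1 : ZMod (m + 1)))
      = Equiv.Perm.sign (finRotate (m + 1)) := by rw [← h]; rfl
    _ = -1 := by rw [sign_finRotate, Nat.add_sub_cancel, hm.neg_one_pow]

/-- The minus sign is that of an `n`-cycle with `n` even. The orientation signs of the straight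
passages are raised to the even power `n`, so only the detours through `south` remain, one for each
vertex of the row that `S` does not meet from below. -/
theorem matchingPfaffian_add_rowSet {ι : Type*} [Fintype ι] [DecidableEq ι] [NeZero n]
    (hn : Even n) {o : FisherOrientation} (ho : o.ClockwiseOdd)
    (r : ι ⊕ ι ≃ FisherVertex n) {S : GridEdge n → ZMod 2} (hS : IsEvenSet S) :
    matchingPfaffian o r (S + rowSet n) =
      -(∏ i : ZMod n, if S ((i, -1), .up) = 0 then -1 else 1) * matchingPfaffian o r S := by
  let t : TorusCell n → Option Passage := fun p => if p.2 = 0 then some .westEast else none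
  let next : Equiv.Perm (TorusCell n) :=
    Equiv.prodCongrLeft fun j => if j = 0 then Equiv.addRight 1 else 1
  have t0 (i : ZMod n) : t (i, 0) = some .westEast := if_pos rfl
  have next0 (i : ZMod n) : next (i, 0) = (i + 1, 0) := by simp [next]
  have tnone (p) (h : t p = none) : p.2 ≠ 0 := fun h' => by simp [t, h'] at h
  have tsome (p k) (h : t p = some k) : k = .westEast ∧ ∃ i, p = (i, 0) := by
    by_cases h' : p.2 = 0
    · obtain ⟨i, j⟩ := p
      simp only at h'
      subst h'
      rw [t0] at h
      exact ⟨(Option.some.inj h).symm, i, rfl⟩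
    · simp [t, h'] at h
  obtain ⟨hw, he⟩ := classSign_triangles ho
  rw [matchingPfaffian_toggle o r hS t next]
  · have hsign : Equiv.Perm.sign next = -1 := by
      rw [Equiv.Perm.sign_prodCongrLeft, Finset.prod_eq_single 0]
      · rw [if_pos rfl, sign_addRight_one hn]
      · intro j _ hj
        rw [if_neg hj, Equiv.Perm.sign_one]
      · simp
    have hprod : ∏ p, (t p).elim 1 (fun k => k.sign o (edgeBits S p) * externalSign o k.exit) =
        ∏ i : ZMod n, if S ((i, -1), .up) = 0 then (-1 : ℝ) else 1 := by
      rw [Fintype.prod_prod_type]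
      have hcol (i : ZMod n) : ∏ j, (t (i, j)).elim 1
          (fun k => k.sign o (edgeBits S (i, j)) * externalSign o k.exit) =
          (if S ((i, -1), .up) = 0 then (-1 : ℝ) else 1) *
            (classSign o .westInner * classSign o .aEdge * classSign o .eastOuter *
              classSign o .horizontal) := by
        rw [Finset.prod_eq_single 0]
        · rw [t0, Option.elim_some, Passage.sign_eq o hw he _ (edgeBits_inner S _)
            (edgeBits_outer S _) (hS _)]
          simp [Passage.signValue, externalSign, Passage.exit, edgeBits, halfEdge, mul_assoc]
        · intro j _ hj
          have : t (i, j) = none := if_neg hj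
          rw [this, Option.elim_none]
        · simp
      simp only [hcol, Finset.prod_mul_distrib, Finset.prod_const, Finset.card_univ, ZMod.card]
      have pow (c) : classSign o c ^ n = 1 := by
        obtain ⟨m, rfl⟩ := hn
        rw [pow_add, ← mul_pow, classSign_mul_self, one_pow]
      simp only [pow, mul_one]
    rw [hprod, hsign]
    push_cast
    ring
  · intro p hp
    simp [next, Equiv.prodCongrLeft, tnone p hp]
  · intro p k h
    obtain ⟨rfl, i, rfl⟩ := tsome p k h
    exact ⟨.westEast, by rw [next0, t0], by rw [next0]; rfl⟩
  · intro p hp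
    funext x
    rw [edgeBits_add]
    cases x <;> simp [edgeBits, halfEdge, rowSet, tnone p hp]
  · intro p k h
    obtain ⟨rfl, i, rfl⟩ := tsome p k h
    funext x
    rw [edgeBits_add]
    cases x <;> simp [edgeBits, halfEdge, rowSet, Passage.toggle, Passage.entry, Passage.exit]

/-- As for a row, with the detours now through `east`. -/
theorem matchingPfaffian_add_columnSet {ι : Type*} [Fintype ι] [DecidableEq ι] [NeZero n]
    (hn : Even n) {o : FisherOrientation} (ho : o.ClockwiseOdd)
    (r : ι ⊕ ι ≃ FisherVertex n) {S : GridEdge n → ZMod 2} (hS : IsEvenSet S) :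
    matchingPfaffian o r (S + columnSet n) =
      -(∏ j : ZMod n, if S ((0, j), .right) = 0 then -1 else 1) * matchingPfaffian o r S := by
  let t : TorusCell n → Option Passage := fun p => if p.1 = 0 then some .southNorth else none
  let next : Equiv.Perm (TorusCell n) :=
    Equiv.prodCongrRight fun i => if i = 0 then Equiv.addRight 1 else 1
  have t0 (j : ZMod n) : t (0, j) = some .southNorth := if_pos rfl
  have next0 (j : ZMod n) : next (0, j) = (0, j + 1) := by simp [next]
  have tnone (p) (h : t p = none) : p.1 ≠ 0 := fun h' => by simp [t, h'] at h
  have tsome (p k) (h : t p = some k) : k = .southNorth ∧ ∃ j, p = (0, j) := by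
    by_cases h' : p.1 = 0
    · obtain ⟨i, j⟩ := p
      simp only at h'
      subst h'
      rw [t0] at h
      exact ⟨(Option.some.inj h).symm, j, rfl⟩
    · simp [t, h'] at h
  obtain ⟨hw, he⟩ := classSign_triangles ho
  rw [matchingPfaffian_toggle o r hS t next]
  · have hsign : Equiv.Perm.sign next = -1 := by
      rw [Equiv.Perm.sign_prodCongrRight, Finset.prod_eq_single 0]
      · rw [if_pos rfl, sign_addRight_one hn]
      · intro j _ hj
        rw [if_neg hj, Equiv.Perm.sign_one]
      · simp
    have hprod : ∏ p, (t p).elim 1 (fun k => k.sign o (edgeBits S p) * externalSign o k.exit) =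
        ∏ j : ZMod n, if S ((0, j), .right) = 0 then (-1 : ℝ) else 1 := by
      rw [Fintype.prod_prod_type_right]
      have hrow (j : ZMod n) : ∏ i, (t (i, j)).elim 1
          (fun k => k.sign o (edgeBits S (i, j)) * externalSign o k.exit) =
          (if S ((0, j), .right) = 0 then (-1 : ℝ) else 1) *
            (classSign o .innerSouth * classSign o .aEdge * classSign o .outerNorth *
              classSign o .vertical) := by
        rw [Finset.prod_eq_single 0]
        · rw [t0, Option.elim_some, Passage.sign_eq o hw he _ (edgeBits_inner S _)
            (edgeBits_outer S _) (hS _)]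
          have hbit : edgeBits S (0, j) .east = S ((0, j), .right) := rfl
          by_cases h : S ((0, j), .right) = 0 <;>
            simp only [Passage.signValue, externalSign, Passage.exit, hbit, h, if_true, if_false] <;>
            ring
        · intro i _ hi
          have : t (i, j) = none := if_neg hi
          rw [this, Option.elim_none]
        · simp
      simp only [hrow, Finset.prod_mul_distrib, Finset.prod_const, Finset.card_univ, ZMod.card]
      have pow (c) : classSign o c ^ n = 1 := by
        obtain ⟨m, rfl⟩ := hn
        rw [pow_add, ← mul_pow, classSign_mul_self, one_pow]
      simp only [pow, mul_one]
    rw [hprod, hsign]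
    push_cast
    ring
  · intro p hp
    simp [next, Equiv.prodCongrRight, tnone p hp]
  · intro p k h
    obtain ⟨rfl, j, rfl⟩ := tsome p k h
    exact ⟨.southNorth, by rw [next0, t0], by rw [next0]; rfl⟩
  · intro p hp
    funext x
    rw [edgeBits_add]
    cases x <;> simp [edgeBits, halfEdge, columnSet, tnone p hp]
  · intro p k h
    obtain ⟨rfl, j, rfl⟩ := tsome p k h
    funext x
    rw [edgeBits_add]
    cases x <;> simp [edgeBits, halfEdge, columnSet, Passage.toggle, Passage.entry, Passage.exit]

end Toggles

/-! ### The sign of every even set, and the bijection between even sets and perfect matchings. -/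

section Expansion

variable {n : ℕ}

theorem isEvenSet_faceSet (hn : (1 : ZMod n) ≠ 0) (p : TorusCell n) : IsEvenSet (faceSet p) := by
  obtain ⟨i, j⟩ := p
  rintro ⟨a, b⟩
  have hadd (a : ZMod n) : a + 1 ≠ a := fun h => hn (by simpa using h)
  have hadd' (a : ZMod n) : a ≠ a + 1 := (hadd a).symm
  simp only [edgeBits, halfEdge, faceSet, sub_eq_iff_eq_add]
  by_cases h1 : a = i
  · subst h1
    by_cases h2 : b = j
    · subst h2
      simp [hadd', CharTwo.add_self_eq_zero]
    · by_cases h3 : b = j + 1 <;> simp [h2, h3, hadd', hadd, CharTwo.add_self_eq_zero]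
  · by_cases h1' : a = i + 1
    · subst h1'
      by_cases h2 : b = j
      · subst h2
        simp [hadd', hadd, CharTwo.add_self_eq_zero]
      · by_cases h3 : b = j + 1 <;> simp [h2, h3, hadd, CharTwo.add_self_eq_zero]
    · simp [h1, h1']

theorem faceSpan_le_evenSets (hn : (1 : ZMod n) ≠ 0) : faceSpan n ≤ evenSets n := by
  refine (AddSubgroup.closure_le _).2 ?_
  rintro _ ⟨p, rfl⟩
  exact isEvenSet_faceSet hn p

theorem matchingPfaffian_add_of_mem_faceSpan {ι : Type*} [Fintype ι] [DecidableEq ι] [NeZero n]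
    (hn : (1 : ZMod n) ≠ 0) {o : FisherOrientation} (ho : o.ClockwiseOdd)
    (r : ι ⊕ ι ≃ FisherVertex n) {F : GridEdge n → ZMod 2} (hF : F ∈ faceSpan n) :
    ∀ S, IsEvenSet S → matchingPfaffian o r (S + F) = matchingPfaffian o r S := by
  induction hF using AddSubgroup.closure_induction with
  | mem F hF =>
    obtain ⟨p, rfl⟩ := hF
    exact fun S hS => matchingPfaffian_add_faceSet hn ho r hS p
  | zero => exact fun S _ => by rw [add_zero]
  | add F G hF' _ hF hG =>
    intro S hS
    rw [← add_assoc, hG _ (AddSubgroup.add_mem (evenSets n) hS (faceSpan_le_evenSets hn hF')),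
      hF S hS]
  | neg F _ hF =>
    rwa [show -F = F from funext fun e => CharTwo.neg_eq (F e)]

theorem matchingPfaffian_ne_zero {m : ℕ} [NeZero n]
    (o : FisherOrientation) (r : Fin m ⊕ Fin m ≃ FisherVertex n) {S : GridEdge n → ZMod 2}
    (hS : IsEvenSet S) : matchingPfaffian o r S ≠ 0 := by
  rw [matchingPfaffian, Ne, pfaffianSum_eq_zero_iff r _
    (transpose_matchingMatrix (fisherSign_skew o) (evenMatching_involutive hS))]
  refine det_matchingMatrix_ne_zero (evenMatching_involutive hS).injective ?_
  rintro ⟨p, x⟩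
  by_cases h : edgeBits S p x = 1
  · rw [evenMatching_of_covered (u := (p, x)) h, fisherSign_externalMate]
    cases x <;> first
      | exact absurd h zero_ne_one
      | simp [externalSign, classSign_mul_self]
  · have h0 := ZMod.two_eq_zero_of_ne_one h
    have hmem := localMate_mem_gadgetPairs (edgeBits_inner S p) (edgeBits_outer S p) (hS p) x h0
    rw [evenMatching_of_free h0, fisherSign_inside o p hmem, gadgetSign_mul_self o hmem]

theorem matchingPfaffian_rowSet {ι : Type*} [Fintype ι] [DecidableEq ι] [NeZero n] (hn : Even n)
    {o : FisherOrientation} (ho : o.ClockwiseOdd) (r : ι ⊕ ι ≃ FisherVertex n) :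
    matchingPfaffian o r (rowSet n) = -matchingPfaffian o r 0 := by
  have := matchingPfaffian_add_rowSet hn ho r (AddSubgroup.zero_mem (evenSets n))
  simpa [hn.neg_one_pow] using this

theorem matchingPfaffian_columnSet {ι : Type*} [Fintype ι] [DecidableEq ι] [NeZero n]
    (hn : Even n) {o : FisherOrientation} (ho : o.ClockwiseOdd) (r : ι ⊕ ι ≃ FisherVertex n) :
    matchingPfaffian o r (columnSet n) = -matchingPfaffian o r 0 := by
  have := matchingPfaffian_add_columnSet hn ho r (AddSubgroup.zero_mem (evenSets n))
  simpa [hn.neg_one_pow] using this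

theorem matchingPfaffian_columnSet_add_rowSet {ι : Type*} [Fintype ι] [DecidableEq ι] [NeZero n]
    (hn : Even n) {o : FisherOrientation} (ho : o.ClockwiseOdd) (r : ι ⊕ ι ≃ FisherVertex n) :
    matchingPfaffian o r (columnSet n + rowSet n) = -matchingPfaffian o r 0 := by
  -- The column meets the row from below in exactly one edge, which leaves `n - 1` factors `-1`, an
  -- odd number.
  have hprod : ∏ i : ZMod n, (if columnSet n ((i, -1), .up) = 0 then (-1 : ℝ) else 1) = -1 := by
    have (i : ZMod n) : (if columnSet n ((i, -1), .up) = 0 then (-1 : ℝ) else 1) =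
        -1 * if i = 0 then -1 else 1 := by
      by_cases hi : i = 0 <;> simp [columnSet, hi]
    simp only [this, Finset.prod_mul_distrib, Finset.prod_const, Finset.card_univ, ZMod.card,
      hn.neg_one_pow, Finset.prod_ite_eq', Finset.mem_univ, if_true, one_mul]
  rw [matchingPfaffian_add_rowSet hn ho r isEvenSet_columnSet, hprod,
    matchingPfaffian_columnSet hn ho r]
  ring

/-- The signs of the even sets: those that are sums of boundaries of faces have the sign of the
empty set, all the others have the opposite sign. -/
theorem matchingPfaffian_eq {ι : Type*} [Fintype ι] [DecidableEq ι] [NeZero n] (hn : Even n)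
    {o : FisherOrientation} (ho : o.ClockwiseOdd) (r : ι ⊕ ι ≃ FisherVertex n)
    {S : GridEdge n → ZMod 2} (hS : IsEvenSet S) :
    (S ∈ faceSpan n → matchingPfaffian o r S = matchingPfaffian o r 0) ∧
      (S ∉ faceSpan n → matchingPfaffian o r S = -matchingPfaffian o r 0) := by
  have h1 := one_ne_zero_of_even hn
  have mem (T) (hT : T ∈ faceSpan n) : matchingPfaffian o r T = matchingPfaffian o r 0 := by
    have := matchingPfaffian_add_of_mem_faceSpan h1 ho r hT 0 (AddSubgroup.zero_mem (evenSets n))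
    rwa [zero_add] at this
  refine ⟨mem S, fun hmem => ?_⟩
  obtain ⟨F, hF, h⟩ := exists_faceSpan_add h1 hS
  have hinv := matchingPfaffian_add_of_mem_faceSpan h1 ho r hF
  rcases h with h | h | h | h
  · rw [zero_add] at h
    exact absurd (h ▸ hF) hmem
  · rw [h, hinv _ isEvenSet_rowSet, matchingPfaffian_rowSet hn ho r]
  · rw [h, hinv _ isEvenSet_columnSet, matchingPfaffian_columnSet hn ho r]
  · rw [h, hinv _ (AddSubgroup.add_mem (evenSets n) isEvenSet_columnSet isEvenSet_rowSet),
      matchingPfaffian_columnSet_add_rowSet hn ho r]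

open Classical in
/-- The sums of boundaries of faces are less than half of the even sets. -/
theorem sum_faceSpan_sign_neg {m : ℕ} [NeZero n] (hn : Even n)
    {o : FisherOrientation} (ho : o.ClockwiseOdd) (r : Fin m ⊕ Fin m ≃ FisherVertex n)
    (C : Finset (GridEdge n → ZMod 2)) (hC : ∀ S, S ∈ C ↔ IsEvenSet S) :
    ∑ S ∈ C, (if S ∈ faceSpan n then (1 : ℝ) else -1) < 0 := by
  -- That these cycles are not homologous to zero is read off from the signs: the Pfaffian of the
  -- empty set is nonzero, while theirs is its negative.
  have not_mem (T : GridEdge n → ZMod 2) (hT : IsEvenSet T)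
      (h : matchingPfaffian o r T = -matchingPfaffian o r 0) : T ∉ faceSpan n := by
    intro hmem
    have h0 := matchingPfaffian_ne_zero o r (AddSubgroup.zero_mem (evenSets n))
    rw [(matchingPfaffian_eq hn ho r hT).1 hmem] at h
    exact h0 (by linarith)
  have hsum : IsEvenSet (columnSet n + rowSet n) :=
    AddSubgroup.add_mem (evenSets n) isEvenSet_columnSet isEvenSet_rowSet
  have hrow := not_mem _ isEvenSet_rowSet (matchingPfaffian_rowSet hn ho r)
  have hcolumn := not_mem _ isEvenSet_columnSet (matchingPfaffian_columnSet hn ho r)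
  have hboth := not_mem _ hsum (matchingPfaffian_columnSet_add_rowSet hn ho r)
  set χ : (GridEdge n → ZMod 2) → ℝ := fun S => if S ∈ faceSpan n then (1 : ℝ) else -1 with hχ
  have shift (T : GridEdge n → ZMod 2) (hT : IsEvenSet T) :
      ∑ S ∈ C, χ (S + T) = ∑ S ∈ C, χ S := by
    refine Finset.sum_equiv (Equiv.addRight T) (fun S => ?_) fun S _ => rfl
    rw [hC, hC]
    exact (AddSubgroup.add_mem_cancel_right (evenSets n) hT).symm
  -- At most one of the four translates lies in `faceSpan`, as the difference of any two is a
  -- nontrivial class. Summing over all `S` counts every even set four times.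
  have key (S : GridEdge n → ZMod 2) :
      χ S + χ (S + rowSet n) + χ (S + columnSet n) + χ (S + (columnSet n + rowSet n)) ≤ -2 := by
    have sep (A B : GridEdge n → ZMod 2) (hAB : B - A ∉ faceSpan n)
        (hA : S + A ∈ faceSpan n) : S + B ∉ faceSpan n := fun hB =>
      hAB (by simpa using AddSubgroup.sub_mem _ hB hA)
    have h1 := sep 0 (rowSet n) (by simpa using hrow)
    have h2 := sep 0 (columnSet n) (by simpa using hcolumn)
    have h3 := sep 0 (columnSet n + rowSet n) (by simpa using hboth)
    have hneg : -rowSet n = rowSet n := funext fun e => CharTwo.neg_eq _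
    have h4 := sep (rowSet n) (columnSet n) (by rwa [sub_eq_add_neg, hneg])
    have h5 := sep (rowSet n) (columnSet n + rowSet n) (by simpa using hcolumn)
    have h6 := sep (columnSet n) (columnSet n + rowSet n) (by simpa using hrow)
    rw [add_zero] at h1 h2 h3
    simp only [hχ]
    by_cases m1 : S ∈ faceSpan n
    · rw [if_pos m1, if_neg (h1 m1), if_neg (h2 m1), if_neg (h3 m1)]
      norm_num
    rw [if_neg m1]
    by_cases m2 : S + rowSet n ∈ faceSpan n
    · rw [if_pos m2, if_neg (h4 m2), if_neg (h5 m2)]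
      norm_num
    rw [if_neg m2]
    by_cases m3 : S + columnSet n ∈ faceSpan n
    · rw [if_pos m3, if_neg (h6 m3)]
      norm_num
    rw [if_neg m3]
    split_ifs <;> norm_num
  have hpos : 0 < (C.card : ℝ) := by
    exact_mod_cast Finset.card_pos.2 ⟨0, (hC 0).2 (AddSubgroup.zero_mem (evenSets n))⟩
  have total := Finset.sum_le_sum fun S (_ : S ∈ C) => key S
  rw [Finset.sum_add_distrib, Finset.sum_add_distrib, Finset.sum_add_distrib,
    shift _ isEvenSet_rowSet, shift _ isEvenSet_columnSet, shift _ hsum, Finset.sum_const,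
    nsmul_eq_mul] at total
  linarith

theorem externalMate_ne_of_mem_gadgetPairs {p : TorusCell n} {x y : GadgetVertex}
    (h : (x, y) ∈ gadgetPairs) : externalMate (p, x) ≠ (p, y) := by
  revert h
  cases x <;> cases y <;> first
    | exact fun h => absurd h (by decide)
    | simp [externalMate]

theorem evenMatching_eq_externalMate_iff {S : GridEdge n → ZMod 2} (hS : IsEvenSet S)
    (u : FisherVertex n) : evenMatching S u = externalMate u ↔ edgeBits S u.1 u.2 = 1 := by
  refine ⟨fun h => ?_, evenMatching_of_covered⟩
  by_contra hne
  obtain ⟨p, x⟩ := u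
  have h0 := ZMod.two_eq_zero_of_ne_one hne
  have hmem := localMate_mem_gadgetPairs (edgeBits_inner S p) (edgeBits_outer S p) (hS p) x h0
  rw [evenMatching_of_free h0] at h
  exact externalMate_ne_of_mem_gadgetPairs hmem h.symm

/-- A partial pairing inside a gadget that leaves out only corners is determined by these. -/
theorem gadget_pairing {f : GadgetVertex → GadgetVertex} (hf : ∀ x, f (f x) = x)
    (hadj : ∀ x, (f x = x ∧ x ≠ .inner ∧ x ≠ .outer) ∨ (x, f x) ∈ gadgetPairs)
    {c : GadgetVertex → ZMod 2} (hc : ∀ x, c x = if f x = x then 1 else 0) :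
    c .west + c .south + c .east + c .north = 0 ∧ ∀ x, f x ≠ x → f x = localMate c x := by
  have left : ∀ w ∈ [GadgetVertex.west, .inner, .south], ∀ s ∈ [GadgetVertex.south, .inner, .west],
      ∀ a ∈ [GadgetVertex.west, .south, .outer], (w = .south ↔ s = .west) →
      (w = .inner ↔ a = .west) → (s = .inner ↔ a = .south) →
      (w = .west ∧ s = .south ∧ a = .outer) ∨ (w = .south ∧ s = .west ∧ a = .outer) ∨
        (w = .inner ∧ s = .south ∧ a = .west) ∨ (w = .west ∧ s = .inner ∧ a = .south) := by
    decide
  have right : ∀ e ∈ [GadgetVertex.east, .outer, .north],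
      ∀ n ∈ [GadgetVertex.north, .outer, .east],
      ∀ b ∈ [GadgetVertex.east, .north, .inner], (e = .north ↔ n = .east) →
      (e = .outer ↔ b = .east) → (n = .outer ↔ b = .north) →
      (e = .east ∧ n = .north ∧ b = .inner) ∨ (e = .north ∧ n = .east ∧ b = .inner) ∨
        (e = .outer ∧ n = .north ∧ b = .east) ∨ (e = .east ∧ n = .outer ∧ b = .north) := by
    decide
  have swap (x y : GadgetVertex) : f x = y ↔ f y = x :=
    ⟨fun h => by rw [← h, hf], fun h => by rw [← h, hf]⟩
  have hw : f .west ∈ [GadgetVertex.west, .inner, .south] := by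
    have := hadj .west
    revert this
    cases f .west <;> decide
  have hs : f .south ∈ [GadgetVertex.south, .inner, .west] := by
    have := hadj .south
    revert this
    cases f .south <;> decide
  have ha : f .inner ∈ [GadgetVertex.west, .south, .outer] := by
    have := hadj .inner
    revert this
    cases f .inner <;> decide
  have he : f .east ∈ [GadgetVertex.east, .outer, .north] := by
    have := hadj .east
    revert this
    cases f .east <;> decide
  have hn : f .north ∈ [GadgetVertex.north, .outer, .east] := by
    have := hadj .north
    revert this
    cases f .north <;> decide
  have hb : f .outer ∈ [GadgetVertex.east, .north, .inner] := by
    have := hadj .outer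
    revert this
    cases f .outer <;> decide
  -- The `a`-edge is used in both triangles or in neither; this couples their parities and rules out
  -- half of the sixteen combinations.
  have hab := swap .inner .outer
  have hL := left _ hw _ hs _ ha (swap _ _) (swap _ _) (swap _ _)
  have hR := right _ he _ hn _ hb (swap _ _) (swap _ _) (swap _ _)
  have cw := hc .west
  have cs := hc .south
  have ce := hc .east
  have cn := hc .north
  have finish (hpar : c .west + c .south + c .east + c .north = 0)
      (h1 : f .west ≠ .west → f .west = localMate c .west)
      (h2 : f .south ≠ .south → f .south = localMate c .south)
      (h3 : f .inner = localMate c .inner)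
      (h4 : f .east ≠ .east → f .east = localMate c .east)
      (h5 : f .north ≠ .north → f .north = localMate c .north)
      (h6 : f .outer = localMate c .outer) :
      c .west + c .south + c .east + c .north = 0 ∧ ∀ x, f x ≠ x → f x = localMate c x :=
    ⟨hpar, fun x => match x with
      | .west => h1 | .south => h2 | .inner => fun _ => h3
      | .east => h4 | .north => h5 | .outer => fun _ => h6⟩
  have two : (1 : ZMod 2) + 1 = 0 := rfl
  rcases hL with ⟨h1, h2, h3⟩ | ⟨h1, h2, h3⟩ | ⟨h1, h2, h3⟩ | ⟨h1, h2, h3⟩ <;>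
  rcases hR with ⟨h4, h5, h6⟩ | ⟨h4, h5, h6⟩ | ⟨h4, h5, h6⟩ | ⟨h4, h5, h6⟩ <;>
  first
  | (rw [h3, h6] at hab; exact absurd hab (by decide))
  | (simp only [h1, h2, h4, h5, reduceCtorEq, if_true, if_false] at cw cs ce cn
     refine finish ?_ ?_ ?_ ?_ ?_ ?_ ?_ <;>
       simp [localMate, cw, cs, ce, cn, h1, h2, h3, h4, h5, h6, two])

/-- Every perfect matching of the Fisher graph comes from an even set of grid edges. -/
theorem exists_evenMatching_eq (o : FisherOrientation) {t : FisherVertex n → FisherVertex n}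
    (ht : Function.Involutive t) (hfix : ∀ u, t u ≠ u) (hadj : ∀ u, fisherSign o u (t u) ≠ 0) :
    ∃ S : GridEdge n → ZMod 2, IsEvenSet S ∧ evenMatching S = t := by
  let S : GridEdge n → ZMod 2 := fun e => match e with
    | (p, .right) => if t (p, .east) = externalMate (p, .east) then 1 else 0
    | (p, .up) => if t (p, .north) = externalMate (p, .north) then 1 else 0
  have mate_swap (u) : t (externalMate u) = u ↔ t u = externalMate u :=
    ⟨fun h => by rw [← ht (externalMate u), h], fun h => by rw [← h, ht]⟩
  have mate_swap' (u) :
      t (externalMate u) = externalMate (externalMate u) ↔ t u = externalMate u := by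
    rw [externalMate_involutive, mate_swap]
  have hbits (p x) : edgeBits S p x = if t (p, x) = externalMate (p, x) then 1 else 0 := by
    cases x
    · exact if_congr (mate_swap' (p, .west)) rfl rfl
    · exact if_congr (mate_swap' (p, .south)) rfl rfl
    · have h : t (p, .inner) ≠ externalMate (p, .inner) := hfix _
      rw [if_neg h]
      rfl
    · rfl
    · rfl
    · have h : t (p, .outer) ≠ externalMate (p, .outer) := hfix _
      rw [if_neg h]
      rfl
  have inside (p x) (h : t (p, x) ≠ externalMate (p, x)) :
      ∃ y, t (p, x) = (p, y) ∧ (x, y) ∈ gadgetPairs := by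
    have := hadj (p, x)
    rw [fisherSign, if_neg h, add_zero] at this
    have hp : (t (p, x)).1 = p := by
      by_contra hp
      exact this (if_neg hp)
    rw [if_pos hp] at this
    refine ⟨(t (p, x)).2, Prod.ext hp rfl, ?_⟩
    revert this
    generalize (t (p, x)).2 = y
    cases x <;> cases y <;> first
      | exact fun _ => by decide
      | exact fun h => absurd rfl h
  -- The matching inside each gadget, with fixed points standing for corners that are matched along
  -- a grid edge.
  let f : TorusCell n → GadgetVertex → GadgetVertex := fun p x =>
    if t (p, x) = externalMate (p, x) then x else (t (p, x)).2
  have hf_in (p x) (h : t (p, x) ≠ externalMate (p, x)) :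
      t (p, x) = (p, f p x) ∧ (x, f p x) ∈ gadgetPairs := by
    obtain ⟨y, h1, h2⟩ := inside p x h
    have : f p x = y := by simp only [f]; rw [if_neg h, h1]
    rw [this]
    exact ⟨h1, h2⟩
  have hf_out (p x) (h : t (p, x) = externalMate (p, x)) : f p x = x := if_pos h
  have pairs_symm : ∀ x y, (x, y) ∈ gadgetPairs → (y, x) ∈ gadgetPairs ∧ x ≠ y := by decide
  have hf_iff (p x) : f p x = x ↔ t (p, x) = externalMate (p, x) := by
    refine ⟨fun h => ?_, hf_out p x⟩
    by_contra hne
    exact (pairs_symm _ _ (hf_in p x hne).2).2 h.symm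
  have spec (p) := gadget_pairing (f := f p) (c := edgeBits S p)
    (fun x => by
      by_cases h : t (p, x) = externalMate (p, x)
      · rw [hf_out p x h, hf_out p x h]
      · obtain ⟨h1, h2⟩ := hf_in p x h
        have h3 : t (p, f p x) = (p, x) := by rw [← h1, ht]
        have h4 : t (p, f p x) ≠ externalMate (p, f p x) := by
          rw [h3]
          exact (externalMate_ne_of_mem_gadgetPairs (pairs_symm _ _ h2).1).symm
        have := (hf_in p _ h4).1
        rw [h3] at this
        exact (congrArg Prod.snd this).symm)
    (fun x => by
      by_cases h : t (p, x) = externalMate (p, x)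
      · refine Or.inl ⟨hf_out p x h, ?_, ?_⟩ <;> rintro rfl <;> exact hfix _ h
      · exact Or.inr (hf_in p x h).2)
    (fun x => by simp only [hbits, hf_iff])
  refine ⟨S, fun p => (spec p).1, funext ?_⟩
  rintro ⟨p, x⟩
  by_cases h : t (p, x) = externalMate (p, x)
  · rw [evenMatching_of_covered, h]
    rw [hbits, if_pos h]
  · rw [evenMatching_of_free (by rw [hbits, if_neg h]), (hf_in p x h).1,
      (spec p).2 x (mt (hf_iff p x).1 h)]

/-- The weight of a set of grid edges. -/
def setWeight {E : Type*} [Fintype E] (x : E → ℝ) (S : E → ZMod 2) : ℝ :=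
  ∏ e, if S e = 1 then x e else 1

theorem pfaffianSum_realKasteleyn {ι : Type*} [Fintype ι] [DecidableEq ι] [NeZero n]
    (o : FisherOrientation) (r : ι ⊕ ι ≃ FisherVertex n) (x : GridEdge n → ℝ)
    (C : Finset (GridEdge n → ZMod 2)) (hC : ∀ S, S ∈ C ↔ IsEvenSet S) :
    pfaffianSum ((realKasteleyn o x).submatrix r r) =
      ∑ S ∈ C, setWeight x S * matchingPfaffian o r S := by
  -- The weight of an edge is assigned to its left or lower end.
  let ω : (GridEdge n → ZMod 2) → FisherVertex n → ℝ := fun S u =>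
    if edgeBits S u.1 u.2 = 1 ∧ (u.2 = .east ∨ u.2 = .north) then halfEdge 1 x u else 1
  rw [pfaffianSum_eq_sum_matchings r (realKasteleyn o x) (ε := fisherSign o) (w := pairWeight x)
    (fun _ _ => rfl) C evenMatching ω (fisherSign_skew o)]
  · refine Finset.sum_congr rfl fun S _ => ?_
    congr 1
    have hω : ∏ v, ω S v = ∏ p, ∏ a, ω S (p, a) := Fintype.prod_prod_type _
    have hx : setWeight x S = ∏ p, ∏ d, if S (p, d) = 1 then x (p, d) else 1 :=
      Fintype.prod_prod_type _
    rw [hω, hx]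
    refine Finset.prod_congr rfl fun p _ => ?_
    have h1 : (Finset.univ : Finset GadgetVertex) =
      {.west, .south, .inner, .east, .north, .outer} := rfl
    have h2 : (Finset.univ : Finset GridDir) = {.right, .up} := rfl
    rw [h1, h2]
    simp [ω, edgeBits, halfEdge]
  · intro S hS T hT h
    have hST (u : FisherVertex n) : edgeBits S u.1 u.2 = edgeBits T u.1 u.2 := by
      have h1 := evenMatching_eq_externalMate_iff ((hC S).1 hS) u
      rw [h, evenMatching_eq_externalMate_iff ((hC T).1 hT) u] at h1
      revert h1
      generalize edgeBits S u.1 u.2 = a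
      generalize edgeBits T u.1 u.2 = b
      revert a b
      decide
    funext e
    rcases e with ⟨p, _ | _⟩
    · exact hST (p, .east)
    · exact hST (p, .north)
  · intro t ht hfix hadj
    obtain ⟨S, hS, rfl⟩ := exists_evenMatching_eq o ht hfix hadj
    exact ⟨S, (hC S).2 hS, rfl⟩
  · exact fun S hS => evenMatching_involutive ((hC S).1 hS)
  · rintro S hS ⟨p, a⟩
    by_cases h : edgeBits S p a = 1
    · rw [evenMatching_of_covered (u := (p, a)) h, pairWeight, if_pos rfl]
      have h' := edgeBits_externalMate S (p, a)
      rw [h] at h'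
      have h'' := halfEdge_externalMate 1 x (p, a)
      simp only [ω, h, h', h'']
      cases a <;> first
        | exact absurd h zero_ne_one
        | simp [externalMate]
    · have h0 := ZMod.two_eq_zero_of_ne_one h
      have hS' := (hC S).1 hS p
      have hmem := localMate_mem_gadgetPairs (edgeBits_inner S p) (edgeBits_outer S p) hS' a h0
      have hbit := (localMate_spec (edgeBits_inner S p) (edgeBits_outer S p) hS' a h0).1
      rw [evenMatching_of_free h0, pairWeight, if_neg (externalMate_ne_of_mem_gadgetPairs hmem).symm]
      simp [ω, h0, hbit]

end Expansion

/-! ### A correlation inequality for sums over groups of sets. -/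

section Correlation

variable {E : Type*} [Fintype E]

/-- The nontrivial character of the integers modulo two. -/
def parityCharacter (a : ZMod 2) : ℝ := if a = 1 then -1 else 1

theorem parityCharacter_add (a b : ZMod 2) :
    parityCharacter (a + b) = parityCharacter a * parityCharacter b := by
  have : ∀ a b : ZMod 2, (a = 1 ∧ b = 1 ∧ a + b ≠ 1) ∨ (a ≠ 1 ∧ b = 1 ∧ a + b = 1) ∨
    (a = 1 ∧ b ≠ 1 ∧ a + b = 1) ∨ (a ≠ 1 ∧ b ≠ 1 ∧ a + b ≠ 1) := by decide
  have := this a b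
  generalize a + b = c at this ⊢
  rcases this with ⟨h1, h2, h3⟩ | ⟨h1, h2, h3⟩ | ⟨h1, h2, h3⟩ | ⟨h1, h2, h3⟩ <;>
    simp only [parityCharacter, h1, h2, h3, if_true, if_false] <;> ring

/-- The product is a character of the group: a trivial one sums to the order of the group, and a
nontrivial one sums to 0 by translation invariance. -/
theorem sum_prod_parityCharacter_nonneg (A : AddSubgroup (E → ZMod 2))
    (D : Finset (E → ZMod 2)) (hD : ∀ a, a ∈ D ↔ a ∈ A) (U : Finset E) :
    0 ≤ ∑ a ∈ D, ∏ f ∈ U, parityCharacter (a f) := by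
  by_cases h : ∀ b ∈ A, ∏ f ∈ U, parityCharacter (b f) = 1
  · exact Finset.sum_nonneg fun a ha => by rw [h a ((hD a).1 ha)]; exact zero_le_one
  · push Not at h
    obtain ⟨b, hb, hne⟩ := h
    have shift : ∑ a ∈ D, ∏ f ∈ U, parityCharacter ((a + b) f) =
        ∑ a ∈ D, ∏ f ∈ U, parityCharacter (a f) := by
      refine Finset.sum_equiv (Equiv.addRight b) (fun S => ?_) fun S _ => rfl
      rw [hD, hD]
      exact (AddSubgroup.add_mem_cancel_right A hb).symm
    simp only [Pi.add_apply, parityCharacter_add, Finset.prod_mul_distrib,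
      ← Finset.sum_mul] at shift
    refine ge_of_eq ?_
    by_contra h0
    exact hne (mul_left_cancel₀ h0 (by rw [shift, mul_one]))

/-- Expanding the product gives nonnegative character sums whose coefficients are monomials in `p`
and `q`; replacing `q` by `r` can only lower these coefficients. -/
theorem sum_prod_parityCharacter_mono [DecidableEq E] (A : AddSubgroup (E → ZMod 2))
    (D : Finset (E → ZMod 2)) (hD : ∀ a, a ∈ D ↔ a ∈ A) {p q r : E → ℝ} (hp : ∀ f, 0 ≤ p f)
    (hr : ∀ f, |r f| ≤ q f) :
    ∑ a ∈ D, ∏ f, (p f + r f * parityCharacter (a f)) ≤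
      ∑ a ∈ D, ∏ f, (p f + q f * parityCharacter (a f)) := by
  have expand (q : E → ℝ) : ∑ a ∈ D, ∏ f, (p f + q f * parityCharacter (a f)) =
      ∑ T ∈ Finset.univ.powerset, ((∏ f ∈ T, p f) * ∏ f ∈ Finset.univ \ T, q f) *
        ∑ a ∈ D, ∏ f ∈ Finset.univ \ T, parityCharacter (a f) := by
    simp only [Finset.prod_add, Finset.prod_mul_distrib, Finset.mul_sum]
    rw [Finset.sum_comm]
    exact Finset.sum_congr rfl fun T _ => Finset.sum_congr rfl fun a _ => by ring
  rw [expand, expand]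
  refine Finset.sum_le_sum fun T _ => ?_
  refine mul_le_mul_of_nonneg_right ?_ (sum_prod_parityCharacter_nonneg A D hD _)
  refine mul_le_mul_of_nonneg_left ?_ (Finset.prod_nonneg fun f _ => hp f)
  refine (le_abs_self _).trans ?_
  rw [Finset.abs_prod]
  exact Finset.prod_le_prod (fun f _ => abs_nonneg _) fun f _ => hr f

/-- The proportion of the total weight of a group of sets that is carried by a subgroup decreases
with the weights. -/
theorem sum_setWeight_mul_le {A B : AddSubgroup (E → ZMod 2)} (hAB : A ≤ B)
    {C D : Finset (E → ZMod 2)} (hD : ∀ a, a ∈ D ↔ a ∈ A) (hC : ∀ a, a ∈ C ↔ a ∈ B)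
    {x y : E → ℝ} (h0 : ∀ e, 0 ≤ x e) (hxy : ∀ e, x e ≤ y e) (h1 : ∀ e, y e ≤ 1) :
    (∑ S ∈ D, setWeight y S) * ∑ S ∈ C, setWeight x S ≤
      (∑ S ∈ D, setWeight x S) * ∑ S ∈ C, setWeight y S := by
  classical
  -- Duplicated variables: in the double sum the second set is written as `a + s`, and the
  -- inequality is then proved separately for each fixed `s`.
  have regroup (x y : E → ℝ) : (∑ S ∈ D, setWeight x S) * ∑ S ∈ C, setWeight y S =
      ∑ s ∈ C, ∑ a ∈ D, setWeight x a * setWeight y (a + s) := by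
    rw [Finset.sum_mul, Finset.sum_comm]
    refine Finset.sum_congr rfl fun a ha => ?_
    rw [← Finset.mul_sum]
    congr 1
    symm
    refine Finset.sum_equiv (Equiv.addLeft a) (fun s => ?_) fun s _ => rfl
    rw [hC, hC]
    exact (AddSubgroup.add_mem_cancel_left B (hAB ((hD a).1 ha))).symm
  rw [regroup, regroup]
  refine Finset.sum_le_sum fun s _ => ?_
  -- At an edge outside `s` the factor is 1 or `x f * y f`, and at an edge of `s` it is `y f` or `x
  -- f`, according to the bit of `a`. Each is written as mean plus half difference times the
  -- character; exchanging `x` and `y` only negates the half differences on `s`.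
  have factor (x y : E → ℝ) (a : E → ZMod 2) : setWeight x a * setWeight y (a + s) =
      ∏ f, ((if s f = 1 then (x f + y f) / 2 else (1 + x f * y f) / 2) +
        (if s f = 1 then (y f - x f) / 2 else (1 - x f * y f) / 2) * parityCharacter (a f)) := by
    rw [setWeight, setWeight, ← Finset.prod_mul_distrib]
    refine Finset.prod_congr rfl fun f _ => ?_
    rw [Pi.add_apply]
    have : ∀ a b : ZMod 2, (a = 1 ∧ b = 1 ∧ a + b ≠ 1) ∨ (a ≠ 1 ∧ b = 1 ∧ a + b = 1) ∨
      (a = 1 ∧ b ≠ 1 ∧ a + b = 1) ∨ (a ≠ 1 ∧ b ≠ 1 ∧ a + b ≠ 1) := by decide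
    have := this (a f) (s f)
    generalize a f + s f = c at this ⊢
    rcases this with ⟨h1, h2, h3⟩ | ⟨h1, h2, h3⟩ | ⟨h1, h2, h3⟩ | ⟨h1, h2, h3⟩ <;>
      simp only [parityCharacter, h1, h2, h3, if_true, if_false] <;> ring
  simp only [factor]
  have comm (f : E) : (if s f = 1 then (y f + x f) / 2 else (1 + y f * x f) / 2) =
      if s f = 1 then (x f + y f) / 2 else (1 + x f * y f) / 2 := by
    rw [add_comm (y f), mul_comm (y f)]
  simp only [comm]
  refine sum_prod_parityCharacter_mono A D hD (fun f => ?_) fun f => ?_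
  · have := h0 f
    have := (h0 f).trans (hxy f)
    split_ifs <;> positivity
  · have hle : x f * y f ≤ 1 :=
      mul_le_one₀ ((hxy f).trans (h1 f)) ((h0 f).trans (hxy f)) (h1 f)
    split_ifs
    · rw [abs_le]
      constructor <;> linarith [hxy f]
    · rw [mul_comm (y f), abs_of_nonneg (by linarith)]

end Correlation

/-! ### The surface as the zero set of `signedWeight`, whose sign changes one way only. -/

section CriticalSurface

variable {n : ℕ}

theorem transpose_realKasteleyn (o : FisherOrientation) (x : GridEdge n → ℝ) :
    (realKasteleyn o x)ᵀ = -realKasteleyn o x := by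
  ext u v
  have hw : pairWeight x v u = pairWeight x u v := by
    rw [pairWeight, pairWeight]
    by_cases h : v = externalMate u
    · have h' : u = externalMate v := by rw [h, externalMate_involutive]
      rw [if_pos h, if_pos h', h, halfEdge_externalMate]
    · have h' : u ≠ externalMate v := fun h' => h (by rw [h', externalMate_involutive])
      rw [if_neg h, if_neg h']
  simp only [transpose_apply, realKasteleyn, of_apply, Matrix.neg_apply]
  rw [hw, fisherSign_skew]
  ring

theorem card_fisherVertex (n : ℕ) [NeZero n] :
    Fintype.card (FisherVertex n) = 3 * n ^ 2 + 3 * n ^ 2 := by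
  have h : Fintype.card GadgetVertex = 6 := rfl
  simp only [FisherVertex, TorusCell, Fintype.card_prod, ZMod.card, h]
  ring

open Classical in
/-- The sum of the weights of the even sets of edges, counted with a positive sign if they are sums
of boundaries of faces and with a negative sign otherwise. -/
noncomputable def signedWeight [NeZero n] (x : GridEdge n → ℝ) : ℝ :=
  ∑ S with IsEvenSet S, (if S ∈ faceSpan n then 1 else -1) * setWeight x S

/-- The determinant vanishes together with the Pfaffian, and the sign rule factors the Pfaffian as
that of the empty set, which is nonzero, times `signedWeight x`. -/
theorem charPoly_eq_zero_iff [NeZero n] (hn : Even n) {o : FisherOrientation}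
    (ho : o.ClockwiseOdd) (x : GridEdge n → ℝ) :
    charPoly o x 1 1 = 0 ↔ signedWeight x = 0 := by
  classical
  obtain ⟨r⟩ : Nonempty (Fin (3 * n ^ 2) ⊕ Fin (3 * n ^ 2) ≃ FisherVertex n) :=
    Fintype.card_eq.1 (by rw [card_fisherVertex, Fintype.card_sum, Fintype.card_fin])
  have hdet : charPoly o x 1 1 = ((realKasteleyn o x).det : ℂ) := by
    rw [charPoly, kasteleynMatrix_one_one]
    exact ((Complex.ofRealHom).map_det _).symm
  have hsum : pfaffianSum ((realKasteleyn o x).submatrix r r) =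
      matchingPfaffian o r 0 * signedWeight x := by
    rw [pfaffianSum_realKasteleyn o r x {S | IsEvenSet S} (by simp), signedWeight, Finset.mul_sum]
    refine Finset.sum_congr rfl fun S hS => ?_
    have h := matchingPfaffian_eq hn ho r (Finset.mem_filter.1 hS).2
    by_cases hF : S ∈ faceSpan n
    · rw [h.1 hF, if_pos hF]
      ring
    · rw [h.2 hF, if_neg hF]
      ring
  rw [hdet, Complex.ofReal_eq_zero,
    ← pfaffianSum_eq_zero_iff r _ (transpose_realKasteleyn o x), hsum, mul_eq_zero]
  exact or_iff_right (matchingPfaffian_ne_zero o r (AddSubgroup.zero_mem (evenSets n)))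

theorem signedWeight_one_neg [NeZero n] (hn : Even n) {o : FisherOrientation}
    (ho : o.ClockwiseOdd) : signedWeight (fun _ : GridEdge n => 1) < 0 := by
  classical
  obtain ⟨r⟩ : Nonempty (Fin (3 * n ^ 2) ⊕ Fin (3 * n ^ 2) ≃ FisherVertex n) :=
    Fintype.card_eq.1 (by rw [card_fisherVertex, Fintype.card_sum, Fintype.card_fin])
  have := sum_faceSpan_sign_neg hn ho r {S | IsEvenSet S} (by simp)
  simpa [signedWeight, setWeight] using this

theorem signedWeight_zero [NeZero n] : signedWeight (fun _ : GridEdge n => 0) = 1 := by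
  classical
  rw [signedWeight, Finset.sum_eq_single 0]
  · simp [setWeight]
  · intro S _ hS
    obtain ⟨e, he⟩ := Function.ne_iff.1 hS
    have h1 : S e = 1 := by
      by_contra h1
      exact he (ZMod.two_eq_zero_of_ne_one h1)
    have hzero : setWeight (fun _ => 0) S = 0 :=
      Finset.prod_eq_zero (Finset.mem_univ e) (by rw [if_pos h1])
    rw [hzero, mul_zero]
  · intro h
    exact absurd (Finset.mem_filter.2
      ⟨Finset.mem_univ _, AddSubgroup.zero_mem (evenSets n)⟩) h

theorem setWeight_nonneg {E : Type*} [Fintype E] {x : E → ℝ} (hx : ∀ e, 0 ≤ x e)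
    (S : E → ZMod 2) : 0 ≤ setWeight x S := by
  refine Finset.prod_nonneg fun e _ => ?_
  split_ifs
  exacts [hx e, zero_le_one]

/-- The sign of the signed weight can change only from positive to negative as the weights
increase. -/
theorem signedWeight_crossing [NeZero n] (hn : Even n) {x y : GridEdge n → ℝ}
    (h0 : ∀ e, 0 ≤ x e) (hxy : ∀ e, x e ≤ y e) (h1 : ∀ e, y e ≤ 1) :
    (signedWeight x ≤ 0 → signedWeight y ≤ 0) ∧ (0 ≤ signedWeight y → 0 ≤ signedWeight x) := by
  classical
  let D : Finset (GridEdge n → ZMod 2) := {S | S ∈ faceSpan n}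
  let C : Finset (GridEdge n → ZMod 2) := {S | IsEvenSet S}
  have hle := faceSpan_le_evenSets (one_ne_zero_of_even hn)
  have hsplit (x : GridEdge n → ℝ) :
      signedWeight x = 2 * ∑ S ∈ D, setWeight x S - ∑ S ∈ C, setWeight x S := by
    have hDC : D = C.filter (· ∈ faceSpan n) := by
      ext S
      simp only [D, C, Finset.mem_filter, Finset.mem_univ, true_and]
      exact ⟨fun h => ⟨hle h, h⟩, And.right⟩
    rw [hDC, Finset.sum_filter, Finset.mul_sum, ← Finset.sum_sub_distrib]
    refine Finset.sum_congr rfl fun S _ => ?_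
    split_ifs <;> ring
  have pos (A : Finset (GridEdge n → ZMod 2)) (hA : 0 ∈ A) {x : GridEdge n → ℝ}
      (hx : ∀ e, 0 ≤ x e) : 0 < ∑ S ∈ A, setWeight x S := by
    refine Finset.sum_pos' (fun S _ => setWeight_nonneg hx S) ⟨0, hA, ?_⟩
    simp [setWeight]
  have hD : 0 ∈ D := Finset.mem_filter.2 ⟨Finset.mem_univ _, AddSubgroup.zero_mem _⟩
  have hC : 0 ∈ C := Finset.mem_filter.2 ⟨Finset.mem_univ _, AddSubgroup.zero_mem (evenSets n)⟩
  have key := sum_setWeight_mul_le hle (D := D) (C := C) (by simp [D])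
    (fun S => by simp only [C, Finset.mem_filter, Finset.mem_univ, true_and]; rfl) h0 hxy h1
  have hDx := pos D hD h0
  have hDy := pos D hD fun e => (h0 e).trans (hxy e)
  have hCx := pos C hC h0
  have hCy := pos C hC fun e => (h0 e).trans (hxy e)
  rw [hsplit, hsplit]
  constructor
  · intro h
    -- Chains `2 Z₀(x) ≤ Z(x)` with `Z₀(y) Z(x) ≤ Z₀(x) Z(y)` and cancels `Z₀(x) > 0`; the other
    -- implication cancels `Z(y)`.
    have h2 := mul_le_mul_of_nonneg_left (sub_nonpos.1 h) hDy.le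
    have h3 := le_of_mul_le_mul_left
      (show (∑ S ∈ D, setWeight x S) * (2 * ∑ S ∈ D, setWeight y S) ≤
        (∑ S ∈ D, setWeight x S) * ∑ S ∈ C, setWeight y S by linarith) hDx
    linarith
  · intro h
    have h2 := mul_le_mul_of_nonneg_right (sub_nonneg.1 h) hCx.le
    have h3 := le_of_mul_le_mul_left
      (show (∑ S ∈ C, setWeight y S) * ∑ S ∈ C, setWeight x S ≤
        (∑ S ∈ C, setWeight y S) * (2 * ∑ S ∈ D, setWeight x S) by linarith) hCy
    linarith

end CriticalSurface

/-! ### Existence and uniqueness of the zero along the curve. -/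

section Curve

open Filter Topology

theorem Real.strictMono_tanh : StrictMono Real.tanh := by
  intro s t h
  by_contra! hle
  have := Real.artanh_le_artanh (Real.neg_one_lt_tanh t) (Real.tanh_lt_one s) hle
  rw [Real.artanh_tanh, Real.artanh_tanh] at this
  exact absurd h this.not_gt

theorem Real.tendsto_tanh_atTop : Tendsto Real.tanh atTop (𝓝 1) := by
  refine tendsto_order.2 ⟨fun a ha => ?_, fun a ha =>
    Eventually.of_forall fun t => (Real.tanh_lt_one t).trans ha⟩
  have hmem : max a 0 ∈ Set.Ioo (-1 : ℝ) 1 :=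
    ⟨lt_max_of_lt_right (by norm_num), max_lt ha zero_lt_one⟩
  filter_upwards [eventually_gt_atTop (Real.artanh (max a 0))] with t ht
  have := Real.strictMono_tanh ht
  rw [Real.tanh_artanh hmem] at this
  exact (le_max_left _ _).trans_lt this

theorem Real.analyticAt_tanh (t : ℝ) : AnalyticAt ℝ Real.tanh t := by
  have : Real.tanh = fun t => Real.sinh t / Real.cosh t := funext Real.tanh_eq_sinh_div_cosh
  rw [this]
  exact Real.analyticAt_sinh.div Real.analyticAt_cosh (Real.cosh_pos t).ne'

variable {n : ℕ} [NeZero n]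

theorem continuous_signedWeight : Continuous (signedWeight (n := n)) := by
  refine continuous_finsetSum _ fun S _ => continuous_const.mul ?_
  refine continuous_finsetProd _ fun e _ => ?_
  by_cases h : S e = 1
  · simpa only [h, if_true] using continuous_apply e
  · simpa only [h, if_false] using continuous_const

theorem analyticAt_signedWeight_tanh (J : GridEdge n → ℝ) (t : ℝ) :
    AnalyticAt ℝ (fun t => signedWeight fun e => Real.tanh (t * J e)) t := by
  refine Finset.analyticAt_fun_sum _ fun S _ => analyticAt_const.mul ?_
  refine Finset.analyticAt_fun_prod _ fun e _ => ?_
  by_cases h : S e = 1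
  · simp only [h, if_true]
    exact AnalyticAt.fun_comp (g := Real.tanh) (f := fun t => t * J e)
      (Real.analyticAt_tanh (t * J e)) (analyticAt_id.mul analyticAt_const)
  · simp only [h, if_false]
    exact analyticAt_const

theorem signedWeight_tanh_unique (hn : Even n) {J : GridEdge n → ℝ} (hJ : ∀ e, 0 < J e)
    {s t : ℝ} (hs : 0 ≤ s) (ht : 0 ≤ t)
    (hs0 : signedWeight (fun e => Real.tanh (s * J e)) = 0)
    (ht0 : signedWeight (fun e => Real.tanh (t * J e)) = 0) : s = t := by
  wlog hst : s ≤ t generalizing s t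
  · exact (this ht hs ht0 hs0 (le_of_not_ge hst)).symm
  by_contra hne
  have hlt := lt_of_le_of_ne hst hne
  have mono {a b : ℝ} (hab : a ≤ b) (e : GridEdge n) :
      Real.tanh (a * J e) ≤ Real.tanh (b * J e) :=
    Real.strictMono_tanh.monotone (mul_le_mul_of_nonneg_right hab (hJ e).le)
  have nonneg {a : ℝ} (ha : 0 ≤ a) (e : GridEdge n) : 0 ≤ Real.tanh (a * J e) := by
    simpa using mono ha e
  have vanish (u : ℝ) (hu : u ∈ Set.Ioo s t) :
      signedWeight (fun e => Real.tanh (u * J e)) = 0 :=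
    le_antisymm
      ((signedWeight_crossing hn (nonneg hs) (mono hu.1.le)
        fun e => (Real.tanh_lt_one _).le).1 hs0.le)
      ((signedWeight_crossing hn (nonneg (hs.trans hu.1.le)) (mono hu.2.le)
        fun e => (Real.tanh_lt_one _).le).2 ht0.ge)
  obtain ⟨m, hm⟩ := exists_between hlt
  -- The inequality is not strict, so it allows a whole interval of zeros; the identity theorem for
  -- analytic functions excludes one.
  have hzero := AnalyticOnNhd.eqOn_zero_of_preconnected_of_eventuallyEq_zero
    (U := Set.univ) (fun u _ => analyticAt_signedWeight_tanh J u) isPreconnected_univ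
    (Set.mem_univ m)
    (Filter.eventually_of_mem (Ioo_mem_nhds hm.1 hm.2) fun u hu => vanish u hu)
  have h0 := hzero (Set.mem_univ 0)
  simp [signedWeight_zero] at h0

theorem exists_signedWeight_tanh_eq_zero (hn : Even n) {o : FisherOrientation}
    (ho : o.ClockwiseOdd) {J : GridEdge n → ℝ} (hJ : ∀ e, 0 < J e) :
    ∃ t, 0 < t ∧ signedWeight (fun e => Real.tanh (t * J e)) = 0 := by
  have hcont : Continuous fun t => signedWeight fun e => Real.tanh (t * J e) :=
    continuous_iff_continuousAt.2 fun t => (analyticAt_signedWeight_tanh J t).continuousAt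
  have hlim : Tendsto (fun t => signedWeight fun e => Real.tanh (t * J e)) atTop
      (𝓝 (signedWeight fun _ : GridEdge n => 1)) :=
    (continuous_signedWeight.tendsto _).comp (tendsto_pi_nhds.2 fun e =>
      Real.tendsto_tanh_atTop.comp (tendsto_id.atTop_mul_const (hJ e)))
  obtain ⟨T, hT, hneg⟩ := ((eventually_gt_atTop (0 : ℝ)).and
    (hlim.eventually_lt_const (signedWeight_one_neg hn ho))).exists
  have h0 : signedWeight (fun e => Real.tanh (0 * J e)) = 1 := by
    simpa using signedWeight_zero (n := n)
  obtain ⟨t, ht, hzero⟩ := intermediate_value_Icc' hT.le hcont.continuousOn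
    (show (0 : ℝ) ∈ Set.Icc _ _ from ⟨hneg.le, by rw [h0]; exact zero_le_one⟩)
  refine ⟨t, lt_of_le_of_ne ht.1 ?_, hzero⟩
  rintro rfl
  exact zero_ne_one (hzero.symm.trans h0)

end Curve

theorem lemma4p13 (n : ℕ) [NeZero n] (hn : Even n)
    (o : FisherOrientation) (ho : o.ClockwiseOdd)
    (J : GridEdge n → ℝ) (hJ : ∀ e, 0 < J e) :
    ∃ t₀ : ENNReal, 0 < t₀ ∧ t₀ < ⊤ ∧
      Set.range (weightCurve J) ∩ criticalSurface n o = {weightCurve J t₀} ∧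
      ∀ t : ENNReal, weightCurve J t ∈ criticalSurface n o ↔ t = t₀ := by
  obtain ⟨t₀, hpos, hzero⟩ := exists_signedWeight_tanh_eq_zero hn ho hJ
  have htop : weightCurve J ⊤ = fun _ => 1 := funext fun e => if_pos rfl
  have hreal {t : ENNReal} (ht : t ≠ ⊤) :
      weightCurve J t = fun e => Real.tanh (t.toReal * J e) := funext fun e => if_neg ht
  have unique (t : ENNReal) :
      weightCurve J t ∈ criticalSurface n o ↔ t = ENNReal.ofReal t₀ := by
    change charPoly o (weightCurve J t) 1 1 = 0 ↔ _
    rw [charPoly_eq_zero_iff hn ho]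
    -- At infinity all weights are 1, where `signedWeight` is negative; finite parameters reduce to
    -- the real case.
    by_cases ht : t = ⊤
    · subst ht
      rw [htop]
      exact iff_of_false (signedWeight_one_neg hn ho).ne ENNReal.ofReal_ne_top.symm
    · rw [hreal ht]
      constructor
      · intro h
        rw [← signedWeight_tanh_unique hn hJ ENNReal.toReal_nonneg hpos.le h hzero,
          ENNReal.ofReal_toReal ht]
      · rintro rfl
        rwa [ENNReal.toReal_ofReal hpos.le]
  refine ⟨ENNReal.ofReal t₀, ENNReal.ofReal_pos.2 hpos, ENNReal.ofReal_lt_top, ?_, unique⟩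
  refine Set.eq_singleton_iff_unique_mem.2 ⟨⟨⟨_, rfl⟩, (unique _).2 rfl⟩, ?_⟩
  rintro _ ⟨⟨t, rfl⟩, ht⟩
  rw [(unique t).1 ht]
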